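/- **Proposition 5.1.** Let $k$ be a field and let $A$ and $B$ be finite dimensional associative $k$-algebras with identity which are singularly equivalent of Morita type with level. Then $A$ is syzygy-finite if and only if $B$ is syzygy-finite, and $A$ is Igusa–Todorov if and only if $B$ is Igusa–Todorov. Here modules are left modules, $k$ acts centrally on bimodules, and $A^e=A\otimes_k A^{op}$, so that $A$-$A$-bimodules are left $A^e$-modules. For a finitely generated module $X$ and $n\ge 0$, an $n$-th syzygy of $X$ is a module $K$ for which there is an exact sequence $0\to K\to P_{n-1}\to\cdots\to P_0\to X\to 0$ with all $P_i$ finitely generated projective (for $n=0$: $K\cong X$). It is unique up to projective direct summands, and its class in the stable category of finitely generated modules (modulo the maps factoring through finitely generated projective modules) is denoted $\Omega^n(X)$. * $A$ and $B$ are *singularly equivalent of Morita type with level* if, for some $n\ge 0$, there are an $A$-$B$-bimodule $M$ and a $B$-$A$-bimodule $N$ such that ${}_AM$, $M_B$, ${}_BN$, $N_A$ are finitely generated projective, and $M\otimes_B N\cong\Omega^n_{A^e}(A)$ and $N\otimes_A M\cong\Omega^n_{B^e}(B)$ in the stable categories of finitely generated $A^e$-modules and $B^e$-modules, respectively. * $A$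 is *syzygy-finite* if there is an integer $s\ge 0$ such that the class of all $n$-th syzygies, $n>s$, of finitely generated $A$-modules is representation-finite, i.e. up to isomorphism only finitely many indecomposable modules occur as direct summands of modules in this class. * $A$ is *Igusa–Todorov* if there are a finitely generated $A$-module $V$ and an integer $n\ge 0$ such that for every $n$-th syzygy $K$ of a finitely generated $A$-module there is an exact sequence $0\to V_1\to V_0\to K\to 0$ in which $V_1$ and $V_0$ are direct summands of finite direct sums of copies of $V$. -/

import Mathlib

universe u

open scoped TensorProduct

namespace SingularMorita

/-! ### Finitely generated modules, summands, indecomposables, syzygies -/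

section Modules

variable (R : Type u) [Ring R]

/-- `X` is isomorphic to a direct summand of `Y`. -/
def IsDirectSummand (X Y : Type u) [AddCommGroup X] [Module R X] [AddCommGroup Y] [Module R Y] :
    Prop :=
  ∃ (i : X →ₗ[R] Y) (r : Y →ₗ[R] X), r ∘ₗ i = LinearMap.id

/-- `X` belongs to `add V`: it is a direct summand of a finite direct sum of copies of `V`. -/
def IsInAdd (X V : Type u) [AddCommGroup X] [Module R X] [AddCommGroup V] [Module R V] : Prop :=
  ∃ r : ℕ, IsDirectSummand R X (Fin r → V)

/-- `X` is indecomposable: nonzero, and not the direct sum of two nonzero submodules. -/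
def IsIndecomposable (X : Type u) [AddCommGroup X] [Module R X] : Prop :=
  Nontrivial X ∧ ∀ p q : Submodule R X, IsCompl p q → p = ⊥ ∨ q = ⊥

variable {R} in
/-- The map `f` factors through a finitely generated projective module, that is,
it becomes zero in the stable category of finitely generated modules. -/
def FactorsThroughProjective {X Y : Type u} [AddCommGroup X] [Module R X]
    [AddCommGroup Y] [Module R Y] (f : X →ₗ[R] Y) : Prop :=
  ∃ (P : ModuleCat.{u} R) (g : X →ₗ[R] P) (h : P →ₗ[R] Y),
    Module.Finite R P ∧ Module.Projective R P ∧ f = h ∘ₗ g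

/-- `X` and `Y` are isomorphic in the stable category of `R`-modules, whose morphisms are the
`R`-linear maps modulo those that factor through a finitely generated projective module. -/
def StablyIsomorphic (X Y : Type u) [AddCommGroup X] [Module R X]
    [AddCommGroup Y] [Module R Y] : Prop :=
  ∃ (f : X →ₗ[R] Y) (g : Y →ₗ[R] X),
    FactorsThroughProjective (g ∘ₗ f - LinearMap.id) ∧
    FactorsThroughProjective (f ∘ₗ g - LinearMap.id)

/-- `IsSyzygy R n X K`: the module `K` is an `n`-th syzygy of `X`, i.e. there is an exact sequence
`0 → K → Pₙ₋₁ → ⋯ → P₀ → X → 0` with all `Pᵢ` finitely generated projective (for `n = 0`,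
`K ≅ X`). Up to projective direct summands `K` is unique. -/
def IsSyzygy : ℕ → ModuleCat.{u} R → ModuleCat.{u} R → Prop
  | 0, X, K => Nonempty (K ≃ₗ[R] X)
  | n + 1, X, K => ∃ (Y P : ModuleCat.{u} R) (f : K →ₗ[R] P) (g : P →ₗ[R] Y),
      IsSyzygy n X Y ∧ Module.Finite R P ∧ Module.Projective R P ∧
      Function.Injective f ∧ Function.Exact f g ∧ Function.Surjective g

/-- A class `C` of modules is representation-finite: up to isomorphism, only finitely many
finitely generated indecomposable modules occur as direct summands of modules in `C`. -/
def IsRepresentationFinite (C : ModuleCat.{u} R → Prop) : Prop :=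
  ∃ (r : ℕ) (L : Fin r → ModuleCat.{u} R), ∀ X : ModuleCat.{u} R,
    Module.Finite R X → IsIndecomposable R X → (∃ K, C K ∧ IsDirectSummand R X K) →
      ∃ i, Nonempty (X ≃ₗ[R] L i)

/-- `R` is syzygy-finite: for some `s`, the class of all `n`-th syzygies with `n > s` of finitely
generated modules is representation-finite. -/
def IsSyzygyFinite : Prop :=
  ∃ s : ℕ, IsRepresentationFinite R fun K =>
    ∃ (n : ℕ) (X : ModuleCat.{u} R), s < n ∧ Module.Finite R X ∧ IsSyzygy R n X K

/-- `R` is Igusa-Todorov: there are a finitely generated module `V` and an `n` such that every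
`n`-th syzygy `K` of a finitely generated module admits an exact sequence
`0 → V₁ → V₀ → K → 0` with `V₁, V₀ ∈ add V`. -/
def IsIgusaTodorov : Prop :=
  ∃ (V : ModuleCat.{u} R) (n : ℕ), Module.Finite R V ∧
    ∀ X K : ModuleCat.{u} R, Module.Finite R X → IsSyzygy R n X K →
      ∃ (V₁ V₀ : ModuleCat.{u} R) (f : V₁ →ₗ[R] V₀) (g : V₀ →ₗ[R] K),
        IsInAdd R V₁ V ∧ IsInAdd R V₀ V ∧
        Function.Injective f ∧ Function.Exact f g ∧ Function.Surjective g

end Modules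

/-! ### Tensor product of bimodules over a noncommutative algebra

An `A`-`B`-bimodule (with `k` acting centrally) is a `k`-module `M` with commuting actions of `A`
and of `Bᵐᵒᵖ` that both extend the action of `k`. -/

section Tensor

variable (k : Type u) [Field k] (A B C : Type u) [Ring A] [Algebra k A] [Ring B]
  [Ring C] [Algebra k C]
  (M N : Type u)
  [AddCommGroup M] [Module k M] [Module A M] [Module Bᵐᵒᵖ M]
  [IsScalarTower k A M] [SMulCommClass A Bᵐᵒᵖ M]
  [AddCommGroup N] [Module k N] [Module B N] [Module Cᵐᵒᵖ N]
  [IsScalarTower k Cᵐᵒᵖ N] [SMulCommClass B Cᵐᵒᵖ N]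

/-- The relations `mb ⊗ n = m ⊗ bn`. -/
def balancedRel (k : Type u) [Field k] (B : Type u) [Ring B] (M N : Type u)
    [AddCommGroup M] [Module k M] [Module Bᵐᵒᵖ M] [AddCommGroup N] [Module k N] [Module B N] :
    Submodule k (M ⊗[k] N) :=
  Submodule.span k {x | ∃ (b : B) (m : M) (n : N),
    x = (MulOpposite.op b • m) ⊗ₜ[k] n - m ⊗ₜ[k] (b • n)}

/-- The tensor product `M ⊗_B N` of a right `B`-module and a left `B`-module. -/
abbrev TensorOver (k : Type u) [Field k] (B : Type u) [Ring B] (M N : Type u)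
    [AddCommGroup M] [Module k M] [Module Bᵐᵒᵖ M] [AddCommGroup N] [Module k N] [Module B N] :
    Type u :=
  (M ⊗[k] N) ⧸ balancedRel k B M N

/-- The left action `a (m ⊗ n) = am ⊗ n` of `A` on `M ⊗_B N`. -/
def leftAction : A →ₐ[k] Module.End k (TensorOver k B M N) where
  toFun a := (balancedRel k B M N).mapQ (balancedRel k B M N)
    ((Algebra.lsmul k k M a).rTensor N) (by
      refine Submodule.span_le.2 ?_
      rintro _ ⟨b, m, n, rfl⟩
      refine Submodule.subset_span ⟨b, a • m, n, ?_⟩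
      simp [smul_comm a (MulOpposite.op b) m])
  map_one' := by
    ext m n
    exact congrArg (Submodule.Quotient.mk (p := balancedRel k B M N))
      (show ((1 : A) • m) ⊗ₜ[k] n = m ⊗ₜ[k] n by rw [one_smul])
  map_mul' a b := by
    ext m n
    exact congrArg (Submodule.Quotient.mk (p := balancedRel k B M N))
      (show ((a * b) • m) ⊗ₜ[k] n = (a • b • m) ⊗ₜ[k] n by rw [mul_smul])
  map_zero' := by
    ext m n
    exact congrArg (Submodule.Quotient.mk (p := balancedRel k B M N))
      (show ((0 : A) • m) ⊗ₜ[k] n = (0 : M ⊗[k] N) by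
        rw [zero_smul, TensorProduct.zero_tmul])
  map_add' a b := by
    ext m n
    exact congrArg (Submodule.Quotient.mk (p := balancedRel k B M N))
      (show ((a + b) • m) ⊗ₜ[k] n = (a • m) ⊗ₜ[k] n + (b • m) ⊗ₜ[k] n by
        rw [add_smul, TensorProduct.add_tmul])
  commutes' c := by
    ext m n
    exact congrArg (Submodule.Quotient.mk (p := balancedRel k B M N))
      (show (algebraMap k A c • m) ⊗ₜ[k] n = c • m ⊗ₜ[k] n by
        rw [algebraMap_smul, TensorProduct.smul_tmul'])

/-- The right action `(m ⊗ n) c = m ⊗ nc` of `C` on `M ⊗_B N`. -/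
def rightAction : Cᵐᵒᵖ →ₐ[k] Module.End k (TensorOver k B M N) where
  toFun c := (balancedRel k B M N).mapQ (balancedRel k B M N)
    ((Algebra.lsmul k k N c).lTensor M) (by
      refine Submodule.span_le.2 ?_
      rintro _ ⟨b, m, n, rfl⟩
      refine Submodule.subset_span ⟨b, m, c • n, ?_⟩
      simp [smul_comm b c n])
  map_one' := by
    ext m n
    exact congrArg (Submodule.Quotient.mk (p := balancedRel k B M N))
      (show m ⊗ₜ[k] ((1 : Cᵐᵒᵖ) • n) = m ⊗ₜ[k] n by rw [one_smul])
  map_mul' a b := by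
    ext m n
    exact congrArg (Submodule.Quotient.mk (p := balancedRel k B M N))
      (show m ⊗ₜ[k] ((a * b) • n) = m ⊗ₜ[k] (a • b • n) by rw [mul_smul])
  map_zero' := by
    ext m n
    exact congrArg (Submodule.Quotient.mk (p := balancedRel k B M N))
      (show m ⊗ₜ[k] ((0 : Cᵐᵒᵖ) • n) = (0 : M ⊗[k] N) by
        rw [zero_smul, TensorProduct.tmul_zero])
  map_add' a b := by
    ext m n
    exact congrArg (Submodule.Quotient.mk (p := balancedRel k B M N))
      (show m ⊗ₜ[k] ((a + b) • n) = m ⊗ₜ[k] (a • n) + m ⊗ₜ[k] (b • n) by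
        rw [add_smul, TensorProduct.tmul_add])
  commutes' c := by
    ext m n
    exact congrArg (Submodule.Quotient.mk (p := balancedRel k B M N))
      (show m ⊗ₜ[k] (algebraMap k Cᵐᵒᵖ c • n) = c • m ⊗ₜ[k] n by
        rw [algebraMap_smul, TensorProduct.tmul_smul])

/-- The action `(a ⊗ c) (m ⊗ n) = am ⊗ nc` of `A ⊗ Cᵐᵒᵖ` on `M ⊗_B N`. -/
def biAction : A ⊗[k] Cᵐᵒᵖ →ₐ[k] Module.End k (TensorOver k B M N) :=
  Algebra.TensorProduct.lift (leftAction k A B M N) (rightAction k B C M N)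
    fun _ _ => by ext m n; rfl

/-- The `A`-`C`-bimodule structure of `M ⊗_B N`, as a left `A ⊗ Cᵐᵒᵖ`-module structure. -/
@[reducible]
def tensorOverModule : Module (A ⊗[k] Cᵐᵒᵖ) (TensorOver k B M N) :=
  Module.compHom (TensorOver k B M N) (biAction k A B C M N).toRingHom

theorem tensorOverModule_smul (a : A) (c : C) (m : M) (n : N) :
    letI := tensorOverModule k A B C M N
    ((a ⊗ₜ[k] MulOpposite.op c) • (Submodule.Quotient.mk (m ⊗ₜ[k] n) : TensorOver k B M N)) =
      Submodule.Quotient.mk ((a • m) ⊗ₜ[k] (MulOpposite.op c • n)) := by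
  have h : biAction k A B C M N (a ⊗ₜ[k] MulOpposite.op c) =
      leftAction k A B M N a * rightAction k B C M N (MulOpposite.op c) :=
    Algebra.TensorProduct.lift_tmul _ _ _ _ _
  exact LinearMap.congr_fun h (Submodule.Quotient.mk (m ⊗ₜ[k] n))

end Tensor

/-! ### Singular equivalences of Morita type with level -/

section Level

variable (k : Type u) [Field k] (A B : Type u) [Ring A] [Algebra k A] [Ring B] [Algebra k B]

/-- The enveloping algebra `Aᵉ = A ⊗ Aᵒᵖ`. -/
abbrev Env : Type u := A ⊗[k] Aᵐᵒᵖ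

/-- `A` as a left `Aᵉ`-module: `(a ⊗ b) • x = a x b`. -/
def regularBimodule : ModuleCat.{u} (Env k A) :=
  letI : Module (Env k A) A := TensorProduct.Algebra.module
  ModuleCat.of (Env k A) A

/-- `M ⊗_B N` as an `A`-`A`-bimodule, i.e. as a left `Aᵉ`-module. -/
def tensorBimodule (M N : Type u)
    [AddCommGroup M] [Module k M] [Module A M] [Module Bᵐᵒᵖ M]
    [IsScalarTower k A M] [IsScalarTower k Bᵐᵒᵖ M] [SMulCommClass A Bᵐᵒᵖ M]
    [AddCommGroup N] [Module k N] [Module B N] [Module Aᵐᵒᵖ N]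
    [IsScalarTower k B N] [IsScalarTower k Aᵐᵒᵖ N] [SMulCommClass B Aᵐᵒᵖ N] :
    ModuleCat.{u} (Env k A) :=
  letI := tensorOverModule k A B A M N
  ModuleCat.of (Env k A) (TensorOver k B M N)

/-- The `A`-`B`-bimodule `M` and the `B`-`A`-bimodule `N` define a singular equivalence of Morita
type with level `n`. -/
structure IsSingularEquivalence (M N : Type u)
    [AddCommGroup M] [Module k M] [Module A M] [Module Bᵐᵒᵖ M]
    [IsScalarTower k A M] [IsScalarTower k Bᵐᵒᵖ M] [SMulCommClass A Bᵐᵒᵖ M]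
    [AddCommGroup N] [Module k N] [Module B N] [Module Aᵐᵒᵖ N]
    [IsScalarTower k B N] [IsScalarTower k Aᵐᵒᵖ N] [SMulCommClass B Aᵐᵒᵖ N]
    (n : ℕ) : Prop where
  finite_left_M : Module.Finite A M
  projective_left_M : Module.Projective A M
  finite_right_M : Module.Finite Bᵐᵒᵖ M
  projective_right_M : Module.Projective Bᵐᵒᵖ M
  finite_left_N : Module.Finite B N
  projective_left_N : Module.Projective B N
  finite_right_N : Module.Finite Aᵐᵒᵖ N
  projective_right_N : Module.Projective Aᵐᵒᵖ N
  /-- `M ⊗_B N ≅ Ωⁿ(A)` in the stable category of `Aᵉ`-modules. -/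
  tensor_MN : ∃ K : ModuleCat.{u} (Env k A), IsSyzygy (Env k A) n (regularBimodule k A) K ∧
    StablyIsomorphic (Env k A) (tensorBimodule k A B M N) K
  /-- `N ⊗_A M ≅ Ωⁿ(B)` in the stable category of `Bᵉ`-modules. -/
  tensor_NM : ∃ K : ModuleCat.{u} (Env k B), IsSyzygy (Env k B) n (regularBimodule k B) K ∧
    StablyIsomorphic (Env k B) (tensorBimodule k B A N M) K

/-- `A` and `B` are singularly equivalent of Morita type with level: some pair of bimodules
defines a singular equivalence of Morita type with level `n`, for some `n ≥ 0`. -/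
def SingularlyEquivalent : Prop :=
  ∃ (n : ℕ)
    (M : Type u) (_ : AddCommGroup M) (_ : Module k M) (_ : Module A M) (_ : Module Bᵐᵒᵖ M)
    (_ : IsScalarTower k A M) (_ : IsScalarTower k Bᵐᵒᵖ M) (_ : SMulCommClass A Bᵐᵒᵖ M)
    (N : Type u) (_ : AddCommGroup N) (_ : Module k N) (_ : Module B N) (_ : Module Aᵐᵒᵖ N)
    (_ : IsScalarTower k B N) (_ : IsScalarTower k Aᵐᵒᵖ N) (_ : SMulCommClass B Aᵐᵒᵖ N),
    IsSingularEquivalence k A B M N n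

end Level

end SingularMorita

/-! Put `F = M ⊗_B -` and `G = N ⊗_A -`. Since `M` and `N` are finitely generated projective on the
right, both functors are exact; since they are so on the left, both preserve finitely generated
projectives, hence syzygies (`BalancedTensor.isSyzygy_map`).

A projective resolution of the bimodule `B` splits as a sequence of right modules, so it stays exact
under `- ⊗_B Y`. Its terms become projective, because `Bᵉ ⊗_B Y` is a retract of `B ⊗_k Y`, which is
free. So `Ωⁿ(B) ⊗_B Y` is an `n`-th syzygy of `Y` (`EnvBimodule.isSyzygy_tensor`). With Schanuel's
lemma and `N ⊗_A M ≅ Ωⁿ(B)`, every `n`-th syzygy `K` of `Y` satisfies `K ⊕ P ≅ GFY ⊕ Q` with `P`,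
`Q` finitely generated projective (`IsSingularEquivalence.stableEq`).

Now an `(m+n)`-th syzygy `K` of `X` is an `n`-th syzygy of some `m`-th syzygy `Y` of `X`, and `FY`
is an `m`-th syzygy of `FX`.

If `A` is syzygy-finite and `m` is large, `FY` is a sum of modules from a finite list `L i`. By
locality of endomorphism rings, every indecomposable summand of `K` is a summand of some `G(L i)` or
of `B`, and there are finitely many of these.

If `A` is Igusa–Todorov, apply `G` to `0 → V₁ → V₀ → FY → 0`, add `Q` to the last two terms and
restrict over `K ⊆ K ⊕ P`. The middle term is the kernel of a surjection onto the projective `P`,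
hence a summand of `GV₀ ⊕ Q`, so `GV ⊕ B` works for `B`.

The hypotheses are symmetric in `A` and `B`, which gives the converses. -/

namespace SingularMorita

/-! ### Maps factoring through projectives and stable equivalence -/

section Stable

variable {R : Type u} [Ring R]

section

variable {W X Y Z : Type u} [AddCommGroup W] [Module R W] [AddCommGroup X] [Module R X]
  [AddCommGroup Y] [Module R Y] [AddCommGroup Z] [Module R Z]

theorem FactorsThroughProjective.of_comp (P : Type u) [AddCommGroup P] [Module R P]
    [Module.Finite R P] [Module.Projective R P] (g : X →ₗ[R] P) (h : P →ₗ[R] Y) :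
    FactorsThroughProjective (h ∘ₗ g) :=
  ⟨ModuleCat.of R P, g, h, ‹_›, ‹_›, rfl⟩

theorem FactorsThroughProjective.comp_left {f : X →ₗ[R] Y} (hf : FactorsThroughProjective f)
    (g : Y →ₗ[R] Z) : FactorsThroughProjective (g ∘ₗ f) := by
  obtain ⟨P, a, b, h₁, h₂, rfl⟩ := hf
  exact ⟨P, a, g ∘ₗ b, h₁, h₂, rfl⟩

theorem FactorsThroughProjective.comp_right {f : X →ₗ[R] Y} (hf : FactorsThroughProjective f)
    (g : W →ₗ[R] X) : FactorsThroughProjective (f ∘ₗ g) := by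
  obtain ⟨P, a, b, h₁, h₂, rfl⟩ := hf
  exact ⟨P, a ∘ₗ g, b, h₁, h₂, rfl⟩

theorem FactorsThroughProjective.zero : FactorsThroughProjective (0 : X →ₗ[R] Y) := by
  simpa using FactorsThroughProjective.of_comp PUnit (0 : X →ₗ[R] PUnit.{u+1})
    (0 : PUnit.{u+1} →ₗ[R] Y)

theorem FactorsThroughProjective.add {f g : X →ₗ[R] Y} (hf : FactorsThroughProjective f)
    (hg : FactorsThroughProjective g) : FactorsThroughProjective (f + g) := by
  obtain ⟨P, a, b, h₁, h₂, rfl⟩ := hf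
  obtain ⟨Q, c, d, h₃, h₄, rfl⟩ := hg
  have := FactorsThroughProjective.of_comp (P × Q) (a.prod c) (b.coprod d)
  convert this using 1
  ext x
  simp

theorem FactorsThroughProjective.neg {f : X →ₗ[R] Y} (hf : FactorsThroughProjective f) :
    FactorsThroughProjective (-f) := by
  simpa using hf.comp_left (-LinearMap.id)

theorem FactorsThroughProjective.sum {ι : Type*} (s : Finset ι) {f : ι → X →ₗ[R] Y}
    (hf : ∀ i, FactorsThroughProjective (f i)) : FactorsThroughProjective (∑ i ∈ s, f i) := by
  classical
  induction s using Finset.induction_on with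
  | empty => simpa using FactorsThroughProjective.zero
  | insert a s ha ih => rw [Finset.sum_insert ha]; exact (hf a).add ih

/-- Such an `X` is a retract of a finitely generated projective. This is the projectivity criterion
used below for values of tensor functors. -/
theorem FactorsThroughProjective.finite_and_projective
    (h : FactorsThroughProjective (LinearMap.id : X →ₗ[R] X)) :
    Module.Finite R X ∧ Module.Projective R X := by
  obtain ⟨P, a, b, h₁, h₂, h₃⟩ := h
  refine ⟨Module.Finite.of_surjective b fun x => ⟨a x, ?_⟩,
    Module.Projective.of_split a b h₃.symm⟩
  exact (LinearMap.congr_fun h₃ x).symm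

end

/-- The dual basis lemma, written as an equation between maps. Any additive functor preserves it, so
no comparison of tensor products with direct sums is needed. -/
theorem exists_sum_comp_eq_id (P : Type u) [AddCommGroup P] [Module R P] [Module.Finite R P]
    [Module.Projective R P] : ∃ (n : ℕ) (p : Fin n → R →ₗ[R] P) (φ : Fin n → P →ₗ[R] R),
      ∑ i, p i ∘ₗ φ i = LinearMap.id := by
  obtain ⟨n, f, g, -, -, h⟩ := Module.Finite.exists_comp_eq_id_of_projective R P
  refine ⟨n, fun i => f ∘ₗ LinearMap.single R (fun _ => R) i, fun i => LinearMap.proj i ∘ₗ g, ?_⟩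
  ext x
  have := LinearMap.congr_fun h x
  simp only [LinearMap.comp_apply, LinearMap.id_apply] at this
  conv_rhs => rw [LinearMap.id_apply, ← this, ← Finset.univ_sum_single (g x), map_sum]
  simp

variable (R) in
/-- `X` and `Y` become isomorphic after adding finitely generated projective summands. -/
def StableEq (X Y : Type u) [AddCommGroup X] [Module R X] [AddCommGroup Y] [Module R Y] : Prop :=
  ∃ P Q : ModuleCat.{u} R, Module.Finite R P ∧ Module.Projective R P ∧ Module.Finite R Q ∧
    Module.Projective R Q ∧ Nonempty ((X × P) ≃ₗ[R] (Y × Q))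

variable {W X Y Z K L : Type u} [AddCommGroup W] [Module R W] [AddCommGroup X] [Module R X]
  [AddCommGroup Y] [Module R Y] [AddCommGroup Z] [Module R Z] [AddCommGroup K] [Module R K]
  [AddCommGroup L] [Module R L]

theorem StableEq.of_equiv (e : X ≃ₗ[R] Y) : StableEq R X Y :=
  ⟨ModuleCat.of R PUnit.{u+1}, ModuleCat.of R PUnit.{u+1},
    inferInstanceAs (Module.Finite R PUnit.{u+1}),
    inferInstanceAs (Module.Projective R PUnit.{u+1}),
    inferInstanceAs (Module.Finite R PUnit.{u+1}),
    inferInstanceAs (Module.Projective R PUnit.{u+1}), ⟨e.prodCongr (LinearEquiv.refl R _)⟩⟩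

theorem StableEq.symm (h : StableEq R X Y) : StableEq R Y X := by
  obtain ⟨P, Q, h₁, h₂, h₃, h₄, ⟨e⟩⟩ := h
  exact ⟨Q, P, h₃, h₄, h₁, h₂, ⟨e.symm⟩⟩

theorem StableEq.trans (h : StableEq R X Y) (h' : StableEq R Y Z) : StableEq R X Z := by
  obtain ⟨P, Q, h₁, h₂, h₃, h₄, ⟨e⟩⟩ := h
  obtain ⟨P', Q', h₁', h₂', h₃', h₄', ⟨e'⟩⟩ := h'
  refine ⟨ModuleCat.of R (P × P'), ModuleCat.of R (Q' × Q),
    inferInstanceAs (Module.Finite R (P × P')), inferInstanceAs (Module.Projective R (P × P')),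
    inferInstanceAs (Module.Finite R (Q' × Q)), inferInstanceAs (Module.Projective R (Q' × Q)),
    ⟨?_⟩⟩
  exact (LinearEquiv.prodAssoc R X P P').symm ≪≫ₗ e.prodCongr (LinearEquiv.refl R P') ≪≫ₗ
    LinearEquiv.prodAssoc R Y Q P' ≪≫ₗ
    (LinearEquiv.refl R Y).prodCongr (LinearEquiv.prodComm R Q P') ≪≫ₗ
    (LinearEquiv.prodAssoc R Y P' Q).symm ≪≫ₗ e'.prodCongr (LinearEquiv.refl R Q) ≪≫ₗ
    LinearEquiv.prodAssoc R Z Q' Q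

theorem nonempty_equiv_prod_of_exact {j : K →ₗ[R] W} {r : W →ₗ[R] X} [Module.Projective R X]
    (hj : Function.Injective j) (hjr : Function.Exact j r) (hr : Function.Surjective r) :
    Nonempty (W ≃ₗ[R] (K × X)) := by
  obtain ⟨l, hl⟩ := Module.projective_lifting_property r LinearMap.id hr
  exact ⟨(hjr.splitSurjectiveEquiv hj ⟨l, hl⟩).1⟩

/-- If `gf - 1 = ba` through `P`, then `(f, a) : X → Y × P` is split by `(g, -b)`. The complement
`ker r` is projective because the projection `1 - ir` onto it factors through a projective, as `fg -
1` does. No Krull–Schmidt argument is required. -/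
theorem StablyIsomorphic.stableEq (h : StablyIsomorphic R X Y) : StableEq R X Y := by
  obtain ⟨f, g, ⟨P, a, b, hP, hP', hgf⟩, hfg⟩ := h
  let i : X →ₗ[R] Y × P := f.prod a
  let r : Y × P →ₗ[R] X := g.coprod (-b)
  have hri : ∀ x, r (i x) = x := fun x => by
    have := LinearMap.congr_fun hgf x
    simp only [LinearMap.sub_apply, LinearMap.comp_apply, LinearMap.id_apply] at this
    simp [i, r, ← this]
  let e : Y × P →ₗ[R] LinearMap.ker r := (LinearMap.id - i ∘ₗ r).codRestrict _ fun y => by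
    simp [hri]
  have he : (LinearMap.ker r).subtype ∘ₗ e = LinearMap.id - i ∘ₗ r := rfl
  have hfac : FactorsThroughProjective (LinearMap.id - i ∘ₗ r) := by
    have h₁ := ((hfg.comp_right (LinearMap.fst R Y P)).comp_left (LinearMap.inl R Y P)).neg
    have h₂ := FactorsThroughProjective.of_comp P (LinearMap.snd R Y P)
      ((f ∘ₗ b).prod (LinearMap.id + a ∘ₗ b))
    have h₃ := FactorsThroughProjective.of_comp P (-a ∘ₗ g ∘ₗ LinearMap.fst R Y P)
      (LinearMap.inr R Y P)
    -- In `1 - ir`, the term `h₁` is the part `y - fg y`, `h₂` collects what depends on the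
    -- `P`-coordinate, and `h₃` is `-ag y` in `P`.
    convert (h₁.add h₂).add h₃ using 1
    ext y <;> simp [i, r]
  have hid : FactorsThroughProjective (LinearMap.id : LinearMap.ker r →ₗ[R] LinearMap.ker r) := by
    have := (hfac.comp_right (LinearMap.ker r).subtype).comp_left e
    convert this using 1
    have hex : ∀ x : LinearMap.ker r, e x = x := fun x => by
      ext1
      show (x : Y × P) - i (r x) = x
      rw [LinearMap.mem_ker.1 x.2, map_zero, sub_zero]
    rw [← he]
    ext1 x
    simp [hex]
  obtain ⟨hC, hC'⟩ := hid.finite_and_projective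
  refine ⟨ModuleCat.of R (LinearMap.ker r), P, hC, hC', hP, hP', ⟨?_⟩⟩
  have hie : ∀ y, i (r y) + (e y : Y × P) = y := fun y => by
    show i (r y) + (y - i (r y)) = y
    abel
  have her : ∀ x : X × LinearMap.ker r, r (i x.1 + x.2) = x.1 := fun x => by
    rw [map_add, hri, LinearMap.mem_ker.1 x.2.2, add_zero]
  exact
    { i.coprod (LinearMap.ker r).subtype with
      invFun := r.prod e
      left_inv := fun x => by
        refine Prod.ext (her x) (Subtype.ext ?_)
        show i x.1 + x.2 - i (r (i x.1 + x.2)) = x.2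
        rw [her, add_sub_cancel_left]
      right_inv := hie }

/-- Schanuel: the pullback `E` of `P` and `P'` over `Y` surjects onto `P'` with kernel `K` and onto
`P` with kernel `L`, and both surjections split. -/
theorem nonempty_schanuel_equiv {P P' Y : Type u} [AddCommGroup P] [Module R P] [AddCommGroup P']
    [Module R P'] [AddCommGroup Y] [Module R Y] [Module.Projective R P] [Module.Projective R P']
    {f : K →ₗ[R] P} {g : P →ₗ[R] Y} {f' : L →ₗ[R] P'} {g' : P' →ₗ[R] Y}
    (hf : Function.Injective f) (hfg : Function.Exact f g) (hg : Function.Surjective g)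
    (hf' : Function.Injective f') (hfg' : Function.Exact f' g') (hg' : Function.Surjective g') :
    Nonempty ((K × P') ≃ₗ[R] (L × P)) := by
  let E : Submodule R (P × P') := LinearMap.eqLocus (g ∘ₗ LinearMap.fst R P P')
    (g' ∘ₗ LinearMap.snd R P P')
  have hE : ∀ x : E, g x.1.1 = g' x.1.2 := fun x => x.2
  let j : K →ₗ[R] E := (LinearMap.inl R P P' ∘ₗ f).codRestrict E fun x => by
    simp [E, hfg.apply_apply_eq_zero]
  let j' : L →ₗ[R] E := (LinearMap.inr R P P' ∘ₗ f').codRestrict E fun x => by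
    simp [E, hfg'.apply_apply_eq_zero]
  have h₁ : Nonempty (E ≃ₗ[R] (K × P')) := by
    refine nonempty_equiv_prod_of_exact (j := j) (r := LinearMap.snd R P P' ∘ₗ E.subtype) ?_ ?_ ?_
    · intro x y hxy
      exact hf (congrArg (fun z : E => z.1.1) hxy)
    · intro x
      constructor
      · intro hx
        have hx' : x.1.2 = 0 := hx
        obtain ⟨y, hy⟩ := (hfg x.1.1).1 (by rw [hE, hx', map_zero])
        exact ⟨y, Subtype.ext (Prod.ext hy hx'.symm)⟩
      · rintro ⟨y, rfl⟩
        rfl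
    · intro y
      obtain ⟨x, hx⟩ := hg (g' y)
      exact ⟨⟨(x, y), hx⟩, rfl⟩
  have h₂ : Nonempty (E ≃ₗ[R] (L × P)) := by
    refine nonempty_equiv_prod_of_exact (j := j') (r := LinearMap.fst R P P' ∘ₗ E.subtype) ?_ ?_ ?_
    · intro x y hxy
      exact hf' (congrArg (fun z : E => z.1.2) hxy)
    · intro x
      constructor
      · intro hx
        have hx' : x.1.1 = 0 := hx
        obtain ⟨y, hy⟩ := (hfg' x.1.2).1 (by rw [← hE, hx', map_zero])
        exact ⟨y, Subtype.ext (Prod.ext hx'.symm hy)⟩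
      · rintro ⟨y, rfl⟩
        rfl
    · intro y
      obtain ⟨x, hx⟩ := hg' (g y)
      exact ⟨⟨(y, x), hx.symm⟩, rfl⟩
  exact ⟨h₁.some.symm ≪≫ₗ h₂.some⟩

/-- Adding `Q` and `Q'` to the last two terms of the sequences leaves the kernels unchanged and
makes the right ends isomorphic, so Schanuel's lemma applies. -/
theorem StableEq.of_exact {P P' Y Y' : Type u} [AddCommGroup P] [Module R P] [AddCommGroup P']
    [Module R P'] [AddCommGroup Y] [Module R Y] [AddCommGroup Y'] [Module R Y']
    [Module.Finite R P] [Module.Projective R P] [Module.Finite R P'] [Module.Projective R P']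
    {f : K →ₗ[R] P} {g : P →ₗ[R] Y} {f' : L →ₗ[R] P'} {g' : P' →ₗ[R] Y'}
    (hf : Function.Injective f) (hfg : Function.Exact f g) (hg : Function.Surjective g)
    (hf' : Function.Injective f') (hfg' : Function.Exact f' g') (hg' : Function.Surjective g')
    (h : StableEq R Y Y') : StableEq R K L := by
  obtain ⟨Q, Q', h₁, h₂, h₃, h₄, ⟨e⟩⟩ := h
  have key := nonempty_schanuel_equiv (f := LinearMap.inl R P Q ∘ₗ f)
    (g := e.toLinearMap ∘ₗ g.prodMap LinearMap.id)
    (f' := LinearMap.inl R P' Q' ∘ₗ f') (g' := g'.prodMap LinearMap.id)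
    (LinearMap.inl_injective.comp hf) ?_
    (e.surjective.comp (hg.prodMap Function.surjective_id))
    (LinearMap.inl_injective.comp hf') ?_ (hg'.prodMap Function.surjective_id)
  · exact ⟨ModuleCat.of R (P' × Q'), ModuleCat.of R (P × Q),
      inferInstanceAs (Module.Finite R (P' × Q')), inferInstanceAs (Module.Projective R (P' × Q')),
      inferInstanceAs (Module.Finite R (P × Q)), inferInstanceAs (Module.Projective R (P × Q)),
      key⟩
  · rintro ⟨x, y⟩
    simp only [LinearMap.comp_apply, LinearEquiv.coe_coe, LinearEquiv.map_eq_zero_iff,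
      LinearMap.prodMap_apply, LinearMap.id_apply, Prod.mk_eq_zero, hfg x, Set.mem_range,
      LinearMap.inl_apply, Prod.mk.injEq]
    constructor
    · rintro ⟨⟨z, rfl⟩, rfl⟩; exact ⟨z, rfl, rfl⟩
    · rintro ⟨z, rfl, rfl⟩; exact ⟨⟨z, rfl⟩, rfl⟩
  · rintro ⟨x, y⟩
    simp only [LinearMap.comp_apply,
      LinearMap.prodMap_apply, LinearMap.id_apply, Prod.mk_eq_zero, hfg' x, Set.mem_range,
      LinearMap.inl_apply, Prod.mk.injEq]
    constructor
    · rintro ⟨⟨z, rfl⟩, rfl⟩; exact ⟨z, rfl, rfl⟩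
    · rintro ⟨z, rfl, rfl⟩; exact ⟨⟨z, rfl⟩, rfl⟩

end Stable

/-! ### Syzygies -/

section Syzygy

variable {R : Type u} [Ring R]

theorem IsSyzygy.stableEq {n : ℕ} {X X' K K' : ModuleCat.{u} R} (hX : StableEq R X X')
    (h : IsSyzygy R n X K) (h' : IsSyzygy R n X' K') : StableEq R K K' := by
  induction n generalizing K K' with
  | zero => exact ((StableEq.of_equiv h.some).trans hX).trans (StableEq.of_equiv h'.some.symm)
  | succ n ih =>
    obtain ⟨Y, P, f, g, hY, _, _, hf, hfg, hg⟩ := h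
    obtain ⟨Y', P', f', g', hY', _, _, hf', hfg', hg'⟩ := h'
    exact StableEq.of_exact hf hfg hg hf' hfg' hg' (ih hY hY')

theorem IsSyzygy.exists_of_add {m n : ℕ} {X K : ModuleCat.{u} R} (h : IsSyzygy R (m + n) X K) :
    ∃ Y, IsSyzygy R m X Y ∧ IsSyzygy R n Y K := by
  induction n generalizing K with
  | zero => exact ⟨K, h, ⟨LinearEquiv.refl R K⟩⟩
  | succ n ih =>
    obtain ⟨Y, P, f, g, hY, h'⟩ := h
    obtain ⟨Z, hZ, hZY⟩ := ih hY
    exact ⟨Z, hZ, Y, P, f, g, hZY, h'⟩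

theorem IsSyzygy.finite [IsNoetherianRing R] {n : ℕ} {X K : ModuleCat.{u} R}
    (hX : Module.Finite R X) (h : IsSyzygy R n X K) : Module.Finite R K := by
  cases n with
  | zero => exact Module.Finite.equiv h.some.symm
  | succ n =>
    obtain ⟨Y, P, f, g, hY, _, _, hf, hfg, hg⟩ := h
    exact Module.Finite.of_injective f hf

end Syzygy

/-! ### Direct summands and indecomposable decompositions -/

section Indecomposable

variable {R : Type u} [Ring R] {X Y Z : Type u} [AddCommGroup X] [Module R X]
  [AddCommGroup Y] [Module R Y] [AddCommGroup Z] [Module R Z]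

theorem IsDirectSummand.refl (X : Type u) [AddCommGroup X] [Module R X] : IsDirectSummand R X X :=
  ⟨LinearMap.id, LinearMap.id, rfl⟩

theorem IsDirectSummand.trans (h : IsDirectSummand R X Y) (h' : IsDirectSummand R Y Z) :
    IsDirectSummand R X Z := by
  obtain ⟨i, r, hri⟩ := h
  obtain ⟨j, s, hsj⟩ := h'
  refine ⟨j ∘ₗ i, r ∘ₗ s, LinearMap.ext fun x => ?_⟩
  exact (congrArg r (LinearMap.congr_fun hsj (i x))).trans (LinearMap.congr_fun hri x)

theorem IsDirectSummand.of_equiv (e : X ≃ₗ[R] Y) : IsDirectSummand R X Y :=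
  ⟨e, e.symm, by ext; simp⟩

theorem IsDirectSummand.fst : IsDirectSummand R X (X × Y) :=
  ⟨LinearMap.inl R X Y, LinearMap.fst R X Y, LinearMap.fst_comp_inl R X Y⟩

theorem IsDirectSummand.snd : IsDirectSummand R Y (X × Y) :=
  ⟨LinearMap.inr R X Y, LinearMap.snd R X Y, LinearMap.snd_comp_inr R X Y⟩

theorem IsDirectSummand.finite (h : IsDirectSummand R X Y) [Module.Finite R Y] :
    Module.Finite R X := by
  obtain ⟨i, r, h⟩ := h
  exact Module.Finite.of_surjective r fun x => ⟨i x, LinearMap.congr_fun h x⟩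

/-- Fitting's lemma: `X = ker fⁿ ⊕ im fⁿ` for large `n`, so `f` is either invertible or nilpotent.
-/
theorem IsIndecomposable.isLocalRing_end [IsArtinian R X] [IsNoetherian R X]
    (h : IsIndecomposable R X) : IsLocalRing (Module.End R X) := by
  have : Nontrivial X := h.1
  refine IsLocalRing.of_isUnit_or_isUnit_one_sub_self fun f => ?_
  obtain ⟨n, hn⟩ := Filter.eventually_atTop.1 (LinearMap.eventually_isCompl_ker_pow_range_pow f)
  -- The exponent `n + 1` is nonzero, so invertibility of the power gives invertibility of `f`.
  have hc := hn (n + 1) n.le_succ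
  rcases h.2 _ _ hc with h₀ | h₀
  · left
    rw [h₀] at hc
    have hu : IsUnit (f ^ (n + 1)) := by
      rw [Module.End.isUnit_iff]
      refine ⟨LinearMap.ker_eq_bot.1 h₀, LinearMap.range_eq_top.1 ?_⟩
      exact eq_top_of_bot_isCompl hc
    exact (isUnit_pow_iff n.succ_ne_zero).1 hu
  · right
    exact IsNilpotent.isUnit_one_sub ⟨n + 1, LinearMap.range_eq_bot.1 h₀⟩

/-- Restricted to `Z`, the sum expresses `1` in a local ring, so one term is a unit and splits `Z`
off `X i`. The maps need not come from a direct sum decomposition, only their sum matters; hence the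
lemma applies to images under an additive functor. -/
theorem isDirectSummand_of_sum_eq_id [IsLocalRing (Module.End R Z)] (h : IsDirectSummand R Z Y)
    {ι : Type*} (s : Finset ι) (X : ι → Type u) [∀ i, AddCommGroup (X i)]
    [∀ i, Module R (X i)] (a : ∀ i, Y →ₗ[R] X i) (b : ∀ i, X i →ₗ[R] Y)
    (hab : ∑ i ∈ s, b i ∘ₗ a i = LinearMap.id) : ∃ i ∈ s, IsDirectSummand R Z (X i) := by
  obtain ⟨j, r, hrj⟩ := h
  have hsum : ∑ i ∈ s, ((r ∘ₗ b i) ∘ₗ (a i ∘ₗ j) : Module.End R Z) = 1 := by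
    ext z
    have h₁ := LinearMap.congr_fun hab (j z)
    have h₂ := LinearMap.congr_fun hrj z
    simp only [LinearMap.sum_apply, LinearMap.comp_apply, LinearMap.id_apply] at h₁ h₂ ⊢
    rw [← map_sum, h₁, h₂, Module.End.one_apply]
  obtain ⟨i, hi, hu⟩ := IsLocalRing.exists_of_isUnit_sum (hsum ▸ isUnit_one)
  obtain ⟨v, hv⟩ := hu.exists_left_inv
  exact ⟨i, hi, a i ∘ₗ j, v ∘ₗ r ∘ₗ b i, hv⟩

theorem isDirectSummand_or_of_prod [IsLocalRing (Module.End R Z)]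
    (h : IsDirectSummand R Z (X × Y)) : IsDirectSummand R Z X ∨ IsDirectSummand R Z Y := by
  obtain ⟨j, r, hrj⟩ := h
  have hsum : IsUnit (((r ∘ₗ LinearMap.inl R X Y) ∘ₗ (LinearMap.fst R X Y ∘ₗ j) : Module.End R Z) +
      ((r ∘ₗ LinearMap.inr R X Y) ∘ₗ (LinearMap.snd R X Y ∘ₗ j) : Module.End R Z)) := by
    convert isUnit_one
    ext z
    have h₂ := LinearMap.congr_fun hrj z
    simp only [LinearMap.add_apply, LinearMap.comp_apply, LinearMap.id_apply] at h₂ ⊢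
    rw [← map_add]
    simpa using h₂
  rcases IsLocalRing.isUnit_or_isUnit_of_isUnit_add hsum with hu | hu
  · obtain ⟨v, hv⟩ := hu.exists_left_inv
    exact Or.inl ⟨_, v ∘ₗ r ∘ₗ LinearMap.inl R X Y, hv⟩
  · obtain ⟨v, hv⟩ := hu.exists_left_inv
    exact Or.inr ⟨_, v ∘ₗ r ∘ₗ LinearMap.inr R X Y, hv⟩

theorem isDirectSummand_ring_of_projective [IsLocalRing (Module.End R Z)]
    [Module.Finite R Y] [Module.Projective R Y] (h : IsDirectSummand R Z Y) :
    IsDirectSummand R Z R := by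
  obtain ⟨n, p, φ, hp⟩ := exists_sum_comp_eq_id (R := R) Y
  obtain ⟨i, -, hi⟩ := isDirectSummand_of_sum_eq_id h _ (fun _ => R) φ p hp
  exact hi

theorem IsDirectSummand.nonempty_equiv (h : IsDirectSummand R Z X) (hX : IsIndecomposable R X)
    [Nontrivial Z] : Nonempty (Z ≃ₗ[R] X) := by
  obtain ⟨i, r, hri⟩ := h
  have hri' : ∀ z, r (i z) = z := LinearMap.congr_fun hri
  have hinj : Function.Injective i := Function.LeftInverse.injective hri'
  have hc : IsCompl (LinearMap.range i) (LinearMap.ker r) := by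
    refine ⟨Submodule.disjoint_def.2 ?_, codisjoint_iff.2 (eq_top_iff.2 fun x _ => ?_)⟩
    · rintro _ ⟨z, rfl⟩ hz
      rw [LinearMap.mem_ker, hri'] at hz
      rw [hz, map_zero]
    · exact Submodule.mem_sup.2 ⟨i (r x), ⟨r x, rfl⟩, x - i (r x), by simp [hri'], by abel⟩
  rcases hX.2 _ _ hc with h₀ | h₀
  · obtain ⟨z, hz⟩ := exists_ne (0 : Z)
    rw [LinearMap.range_eq_bot] at h₀
    exact absurd (hinj (by simp [h₀])) hz
  · rw [h₀] at hc
    exact ⟨LinearEquiv.ofBijective i ⟨hinj, LinearMap.range_eq_top.1 (eq_top_of_isCompl_bot hc)⟩⟩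

/-- Induction on the length. Only the expression of the identity as a sum is recorded, which is all
that the locality argument uses and is kept by additive functors. -/
theorem exists_indecomposable_decomposition (X : Type u) [AddCommGroup X] [Module R X]
    [IsArtinian R X] [IsNoetherian R X] :
    ∃ (ι : Type) (_ : Fintype ι) (L : ι → ModuleCat.{u} R) (a : ∀ i, X →ₗ[R] L i) (b : ∀ i, L i →ₗ[R] X),
      (∀ i, IsIndecomposable R (L i)) ∧ (∀ i, IsDirectSummand R (L i) X) ∧
      ∑ i, b i ∘ₗ a i = LinearMap.id := by
  by_cases h₀ : Subsingleton X
  · exact ⟨Empty, inferInstance, fun i => i.elim, fun i => i.elim, fun i => i.elim, fun i => i.elim,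
      fun i => i.elim, Subsingleton.elim _ _⟩
  by_cases h₁ : IsIndecomposable R X
  · exact ⟨Unit, inferInstance, fun _ => ModuleCat.of R X, fun _ => LinearMap.id, fun _ => LinearMap.id,
      fun _ => h₁, fun _ => IsDirectSummand.refl X, by ext; simp⟩
  obtain ⟨p, q, hpq, hp, hq⟩ : ∃ p q : Submodule R X, IsCompl p q ∧ p ≠ ⊥ ∧ q ≠ ⊥ := by
    simpa [IsIndecomposable, not_subsingleton_iff_nontrivial.1 h₀] using h₁
  have hp' : p ≠ ⊤ := by rintro rfl; exact hq (eq_bot_of_top_isCompl hpq)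
  have hq' : q ≠ ⊤ := by rintro rfl; exact hp (eq_bot_of_isCompl_top hpq)
  -- The two strict inequalities of lengths make the recursion well founded.
  have hdec₁ := Submodule.length_lt hp'
  have hdec₂ := Submodule.length_lt hq'
  obtain ⟨ι, _, L, a, b, hL, hs, hab⟩ := exists_indecomposable_decomposition p
  obtain ⟨ι', _, L', a', b', hL', hs', hab'⟩ := exists_indecomposable_decomposition q
  have hps : IsDirectSummand R p X :=
    IsDirectSummand.fst.trans (.of_equiv (Submodule.prodEquivOfIsCompl p q hpq))
  have hqs : IsDirectSummand R q X :=
    IsDirectSummand.snd.trans (.of_equiv (Submodule.prodEquivOfIsCompl p q hpq))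
  let π₁ : X →ₗ[R] p := LinearMap.fst R p q ∘ₗ (Submodule.prodEquivOfIsCompl p q hpq).symm
  let π₂ : X →ₗ[R] q := LinearMap.snd R p q ∘ₗ (Submodule.prodEquivOfIsCompl p q hpq).symm
  have hπ : ∀ x, (π₁ x : X) + π₂ x = x := fun x => by
    conv_rhs => rw [← (Submodule.prodEquivOfIsCompl p q hpq).apply_symm_apply x]
    rfl
  refine ⟨ι ⊕ ι', inferInstance, Sum.elim L L', ?_, ?_, ?_, ?_, ?_⟩
  · rintro (i | i)
    exacts [a i ∘ₗ π₁, a' i ∘ₗ π₂]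
  · rintro (i | i)
    exacts [p.subtype ∘ₗ b i, q.subtype ∘ₗ b' i]
  · rintro (i | i)
    exacts [hL i, hL' i]
  · rintro (i | i)
    exacts [(hs i).trans hps, (hs' i).trans hqs]
  · rw [Fintype.sum_sum_type]
    have e₁ : ∑ i, (p.subtype ∘ₗ b i) ∘ₗ (a i ∘ₗ π₁) = p.subtype ∘ₗ π₁ := by
      refine LinearMap.ext fun x => ?_
      simpa using congrArg (Subtype.val : p → X) (LinearMap.congr_fun hab (π₁ x))
    have e₂ : ∑ i, (q.subtype ∘ₗ b' i) ∘ₗ (a' i ∘ₗ π₂) = q.subtype ∘ₗ π₂ := by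
      refine LinearMap.ext fun x => ?_
      simpa using congrArg (Subtype.val : q → X) (LinearMap.congr_fun hab' (π₂ x))
    exact (congrArg₂ (· + ·) e₁ e₂).trans (LinearMap.ext hπ)
termination_by Module.length R X

/-- A finitely generated module has only finitely many indecomposable summands. -/
theorem exists_fin_indecomposable_summands [IsArtinianRing R] (V : Type u) [AddCommGroup V]
    [Module R V] [Module.Finite R V] : ∃ (n : ℕ) (L : Fin n → ModuleCat.{u} R),
      ∀ Z : ModuleCat.{u} R, Module.Finite R Z → IsIndecomposable R Z → IsDirectSummand R Z V →
        ∃ i, Nonempty (Z ≃ₗ[R] L i) := by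
  obtain ⟨ι, _, L, a, b, hL, -, hab⟩ := exists_indecomposable_decomposition (R := R) V
  refine ⟨Fintype.card ι, L ∘ (Fintype.equivFin ι).symm, fun Z _ hZ hZV => ?_⟩
  have := hZ.isLocalRing_end
  have := hZ.1
  obtain ⟨i, -, hi⟩ := isDirectSummand_of_sum_eq_id hZV _ (fun i => L i) a b hab
  obtain ⟨e⟩ := hi.nonempty_equiv (hL i)
  obtain ⟨j, rfl⟩ := (Fintype.equivFin ι).symm.surjective i
  exact ⟨j, ⟨e⟩⟩

/-! ### The class `add V` -/

section IsInAdd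

variable {V W : Type u} [AddCommGroup V] [Module R V] [AddCommGroup W] [Module R W]

theorem IsInAdd.of_isDirectSummand (h : IsInAdd R Y V) (hX : IsDirectSummand R X Y) :
    IsInAdd R X V := by
  obtain ⟨r, h⟩ := h
  exact ⟨r, hX.trans h⟩

theorem IsInAdd.mono (h : IsInAdd R X V) (hV : IsDirectSummand R V W) : IsInAdd R X W := by
  obtain ⟨r, h⟩ := h
  obtain ⟨i, s, hs⟩ := hV
  refine ⟨r, h.trans ⟨i.compLeft (Fin r), s.compLeft (Fin r),
    LinearMap.ext fun x => funext fun j => LinearMap.congr_fun hs (x j)⟩⟩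

theorem IsInAdd.prod (h : IsInAdd R X V) (h' : IsInAdd R Y V) : IsInAdd R (X × Y) V := by
  obtain ⟨m, i, r, h⟩ := h
  obtain ⟨n, j, s, h'⟩ := h'
  refine ⟨m + n, IsDirectSummand.trans ⟨i.prodMap j, r.prodMap s, ?_⟩
    (.of_equiv ((LinearEquiv.sumArrowLequivProdArrow (Fin m) (Fin n) R V).symm ≪≫ₗ
      LinearEquiv.funCongrLeft R V finSumFinEquiv.symm))⟩
  rw [LinearMap.prodMap_comp, h, h', LinearMap.prodMap_id]

theorem IsInAdd.of_projective (P : Type u) [AddCommGroup P] [Module R P] [Module.Finite R P]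
    [Module.Projective R P] : IsInAdd R P R := by
  obtain ⟨n, f, g, -, -, h⟩ := Module.Finite.exists_comp_eq_id_of_projective R P
  exact ⟨n, g, f, h⟩

end IsInAdd

end Indecomposable

/-! ### Universal property of the balanced tensor product -/

section TensorOver

variable {k : Type u} [Field k] {B : Type u} [Ring B] {M X : Type u}
  [AddCommGroup M] [Module k M] [Module Bᵐᵒᵖ M] [AddCommGroup X] [Module k X] [Module B X]

@[elab_as_elim]
theorem TensorOver.induction_on {p : TensorOver k B M X → Prop} (t : TensorOver k B M X)
    (zero : p 0) (mk_tmul : ∀ m x, p (Submodule.Quotient.mk (m ⊗ₜ[k] x)))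
    (add : ∀ s t, p s → p t → p (s + t)) : p t := by
  obtain ⟨t, rfl⟩ := Submodule.Quotient.mk_surjective _ t
  induction t with
  | zero => exact zero
  | tmul m x => exact mk_tmul m x
  | add s t hs ht => exact add _ _ hs ht

variable [Algebra k B] [IsScalarTower k Bᵐᵒᵖ M] [IsScalarTower k B X]
  {Z : Type*} [AddCommGroup Z]

/-- The field acts through `B` on both factors, so `B`-balanced implies `k`-balanced; additive maps
into a bare abelian group therefore suffice. -/
theorem map_smul_eq_of_balanced (f : M →+ X →+ Z)
    (hf : ∀ (b : B) m x, f (MulOpposite.op b • m) x = f m (b • x)) (c : k) (m : M) (x : X) :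
    f (c • m) x = f m (c • x) := by
  rw [← algebraMap_smul B c x, ← hf, ← algebraMap_smul Bᵐᵒᵖ c m]
  rfl

/-- A biadditive `B`-balanced map induces an additive map on the balanced tensor product. -/
def TensorOver.lift (f : M →+ X →+ Z)
    (hf : ∀ (b : B) m x, f (MulOpposite.op b • m) x = f m (b • x)) :
    TensorOver k B M X →+ Z :=
  QuotientAddGroup.lift (balancedRel k B M X).toAddSubgroup
    (TensorProduct.liftAddHom f (map_smul_eq_of_balanced f hf)) (by
      intro t ht
      -- `Z` carries no `k`-action, so the span is handled as the additive closure of the scalar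
      -- multiples of the relations, each of which is again a relation.
      refine Submodule.closure_induction (p := fun t _ =>
        TensorProduct.liftAddHom f (map_smul_eq_of_balanced (k := k) f hf) t = 0) ?_ ?_ ?_ ht
      · exact map_zero _
      · intro s t _ _ hs ht
        rw [map_add, hs, ht, add_zero]
      · rintro c _ ⟨b, m, x, rfl⟩
        rw [smul_sub, TensorProduct.smul_tmul', TensorProduct.smul_tmul', map_sub,
          TensorProduct.liftAddHom_tmul, TensorProduct.liftAddHom_tmul, smul_comm, hf, sub_self])

end TensorOver

/-! ### The functor `M ⊗_B -` on `B`-modules -/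

section BalancedTensor

/-- `M ⊗_B X` for a `B`-module `X`, on which `k` acts through `B`. -/
def BalancedTensor (k : Type u) [Field k] (B : Type u) [Ring B] [Algebra k B] (M X : Type u)
    [AddCommGroup M] [Module k M] [Module Bᵐᵒᵖ M] [AddCommGroup X] [Module B X] : Type u :=
  letI : Module k X := Module.compHom X (algebraMap k B)
  TensorOver k B M X

variable (k : Type u) [Field k] {A B : Type u} [Ring A] [Algebra k A] [Ring B] [Algebra k B]
  {M M' : Type u} [AddCommGroup M] [Module k M] [Module A M] [Module Bᵐᵒᵖ M]
  [AddCommGroup M'] [Module k M'] [Module A M'] [Module Bᵐᵒᵖ M']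
  {X Y W : Type u} [AddCommGroup X] [Module B X] [AddCommGroup Y] [Module B Y]
  [AddCommGroup W] [Module B W]

namespace BalancedTensor

theorem isScalarTower_compHom (X : Type u) [AddCommGroup X] [Module B X] :
    letI : Module k X := Module.compHom X (algebraMap k B)
    IsScalarTower k B X :=
  letI : Module k X := Module.compHom X (algebraMap k B)
  IsScalarTower.of_algebraMap_smul fun _ _ => rfl

instance : AddCommGroup (BalancedTensor k B M X) :=
  letI : Module k X := Module.compHom X (algebraMap k B)
  Submodule.Quotient.addCommGroup (balancedRel k B M X)

instance [IsScalarTower k A M] [SMulCommClass A Bᵐᵒᵖ M] : Module A (BalancedTensor k B M X) :=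
  letI : Module k X := Module.compHom X (algebraMap k B)
  Module.compHom (TensorOver k B M X) (leftAction k A B M X).toRingHom

variable (B) in
/-- The class of `m ⊗ x` in `M ⊗_B X`. -/
def tmul : M →+ X →+ BalancedTensor k B M X :=
  letI : Module k X := Module.compHom X (algebraMap k B)
  AddMonoidHom.mk' (fun m => AddMonoidHom.mk'
      (fun x => (Submodule.Quotient.mk (m ⊗ₜ[k] x) : TensorOver k B M X))
      fun x y => congrArg Submodule.Quotient.mk (TensorProduct.tmul_add m x y))
    fun m m' => AddMonoidHom.ext fun x =>
      congrArg Submodule.Quotient.mk (TensorProduct.add_tmul m m' x)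

theorem op_smul_tmul (b : B) (m : M) (x : X) :
    tmul k B (MulOpposite.op b • m) x = tmul k B m (b • x) :=
  letI : Module k X := Module.compHom X (algebraMap k B)
  (Submodule.Quotient.eq _).2 (Submodule.subset_span ⟨b, m, x, rfl⟩)

theorem smul_tmul [IsScalarTower k A M] [SMulCommClass A Bᵐᵒᵖ M] (a : A) (m : M) (x : X) :
    a • tmul k B m x = tmul k B (a • m) x :=
  rfl

@[elab_as_elim]
theorem induction_on {p : BalancedTensor k B M X → Prop} (t : BalancedTensor k B M X)
    (zero : p 0) (tmul : ∀ m x, p (tmul k B m x)) (add : ∀ s t, p s → p t → p (s + t)) : p t :=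
  letI : Module k X := Module.compHom X (algebraMap k B)
  TensorOver.induction_on (k := k) (B := B) (M := M) (X := X) t zero tmul add

variable {k} in
theorem addHom_ext {Z : Type*} [AddCommGroup Z] {f g : BalancedTensor k B M X →+ Z}
    (h : ∀ m x, f (tmul k B m x) = g (tmul k B m x)) : f = g := by
  ext t
  induction t using induction_on with
  | zero => rw [map_zero, map_zero]
  | tmul m x => exact h m x
  | add s t hs ht => rw [map_add, map_add, hs, ht]

variable [IsScalarTower k Bᵐᵒᵖ M] [IsScalarTower k Bᵐᵒᵖ M']

/-- The universal property of `M ⊗_B X`. -/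
def lift {Z : Type*} [AddCommGroup Z] (f : M →+ X →+ Z)
    (hf : ∀ (b : B) m x, f (MulOpposite.op b • m) x = f m (b • x)) :
    BalancedTensor k B M X →+ Z :=
  letI : Module k X := Module.compHom X (algebraMap k B)
  haveI := isScalarTower_compHom k (B := B) X
  TensorOver.lift f hf

@[simp]
theorem lift_tmul {Z : Type*} [AddCommGroup Z] (f : M →+ X →+ Z)
    (hf : ∀ (b : B) m x, f (MulOpposite.op b • m) x = f m (b • x)) (m : M) (x : X) :
    lift k f hf (tmul k B m x) = f m x :=
  rfl

/-- An additive map on `M ⊗_B X` that is `A`-linear on pure tensors is `A`-linear. -/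
def toLinear [IsScalarTower k A M] [SMulCommClass A Bᵐᵒᵖ M] {Z : Type*} [AddCommGroup Z]
    [Module A Z] (f : BalancedTensor k B M X →+ Z)
    (hf : ∀ (a : A) m x, f (tmul k B (a • m) x) = a • f (tmul k B m x)) :
    BalancedTensor k B M X →ₗ[A] Z where
  __ := f
  map_smul' a t := by
    show f (a • t) = a • f t
    induction t using induction_on with
    | zero => simp
    | tmul m x => rw [smul_tmul, hf]
    | add s t hs ht => rw [smul_add, map_add, map_add, hs, ht, smul_add]

section Functor

variable (M)

/-- The additive map `M ⊗_B f`. -/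
def mapAdd (f : X →ₗ[B] Y) : BalancedTensor k B M X →+ BalancedTensor k B M Y :=
  lift k ((AddMonoidHom.compHom' f.toAddMonoidHom).comp (tmul k B)) fun b m x => by
    simp [op_smul_tmul]

variable (A) [IsScalarTower k A M] [SMulCommClass A Bᵐᵒᵖ M]

/-- The `A`-linear map `M ⊗_B f`. -/
def map (f : X →ₗ[B] Y) : BalancedTensor k B M X →ₗ[A] BalancedTensor k B M Y :=
  toLinear k (mapAdd k M f) fun _ _ _ => rfl

@[simp]
theorem map_tmul (f : X →ₗ[B] Y) (m : M) (x : X) :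
    map k A M f (tmul k B m x) = tmul k B m (f x) :=
  rfl

theorem linearMap_ext {Z : Type*} [AddCommGroup Z] [Module A Z]
    {f g : BalancedTensor k B M X →ₗ[A] Z}
    (h : ∀ m x, f (tmul k B m x) = g (tmul k B m x)) : f = g :=
  LinearMap.toAddMonoidHom_injective (addHom_ext h)

theorem map_id : map k A M (LinearMap.id : X →ₗ[B] X) = LinearMap.id :=
  linearMap_ext k A M fun _ _ => rfl

theorem map_comp (g : Y →ₗ[B] W) (f : X →ₗ[B] Y) :
    map k A M (g ∘ₗ f) = map k A M g ∘ₗ map k A M f :=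
  linearMap_ext k A M fun _ _ => rfl

theorem map_sum {ι : Type*} (s : Finset ι) (f : ι → X →ₗ[B] Y) :
    map k A M (∑ i ∈ s, f i) = ∑ i ∈ s, map k A M (f i) :=
  linearMap_ext k A M fun m x => by simp

/-- `M ⊗_B B ≅ M`. -/
def ridLinear : BalancedTensor k B M B →ₗ[A] M :=
  toLinear k (lift k (AddMonoidHom.mk' (fun m => AddMonoidHom.mk'
      (fun b : B => MulOpposite.op b • m) fun b c => by simp [add_smul])
    fun m m' => by ext b; simp) fun b m c => by simp [mul_smul])
    fun a m b => by simp [smul_comm]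

/-- `M ≅ M ⊗_B B`. -/
def ridInv : M →ₗ[A] BalancedTensor k B M B where
  toFun m := tmul k B m 1
  map_add' m m' := by simp
  map_smul' a m := rfl

/-- This one composite suffices: it makes `M ⊗_B B` a retract of `M`. -/
theorem ridInv_comp_ridLinear : ridInv k A (B := B) M ∘ₗ ridLinear k A M = LinearMap.id :=
  linearMap_ext k A M fun m b => by
    show tmul k B (MulOpposite.op b • m) 1 = tmul k B m b
    simp [op_smul_tmul]

theorem isDirectSummand_map (h : IsDirectSummand B X Y) :
    IsDirectSummand A (BalancedTensor k B M X) (BalancedTensor k B M Y) := by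
  obtain ⟨i, r, h⟩ := h
  exact ⟨map k A M i, map k A M r, by rw [← map_comp, h, map_id]⟩

theorem isInAdd_map {V : Type u} [AddCommGroup V] [Module B V] (h : IsInAdd B X V) :
    IsInAdd A (BalancedTensor k B M X) (BalancedTensor k B M V) := by
  obtain ⟨r, h⟩ := h
  refine ⟨r, (isDirectSummand_map k A M h).trans
    ⟨LinearMap.pi fun i => map k A M (LinearMap.proj i),
      ∑ i, map k A M (LinearMap.single B (fun _ => V) i) ∘ₗ LinearMap.proj i, ?_⟩⟩
  refine linearMap_ext k A M fun m x => ?_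
  simp only [LinearMap.comp_apply, LinearMap.sum_apply, LinearMap.pi_apply, LinearMap.proj_apply,
    map_tmul, LinearMap.id_apply]
  rw [← _root_.map_sum]
  exact congrArg _ (Finset.univ_sum_single x)

/-- The identity of `P` is a sum of maps through `B`; after tensoring it is a sum of maps through `M
⊗_B B`, hence through the projective `A`-module `M`. -/
theorem finite_and_projective [Module.Finite A M] [Module.Projective A M]
    (P : Type u) [AddCommGroup P] [Module B P] [Module.Finite B P] [Module.Projective B P] :
    Module.Finite A (BalancedTensor k B M P) ∧ Module.Projective A (BalancedTensor k B M P) := by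
  apply FactorsThroughProjective.finite_and_projective
  obtain ⟨n, p, φ, h⟩ := exists_sum_comp_eq_id (R := B) P
  rw [← map_id, ← h, map_sum]
  refine FactorsThroughProjective.sum _ fun i => ?_
  rw [map_comp, ← LinearMap.id_comp (map k A M (φ i)), ← ridInv_comp_ridLinear,
    LinearMap.comp_assoc]
  exact (FactorsThroughProjective.of_comp M _ _).comp_left _

/-- Coordinates on `M ⊗_B X` given by maps `M → B`. -/
def coords {n : ℕ} (φ : Fin n → M →ₗ[Bᵐᵒᵖ] Bᵐᵒᵖ) (X : Type u) [AddCommGroup X] [Module B X] :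
    BalancedTensor k B M X →+ (Fin n → X) :=
  lift k (AddMonoidHom.mk' (fun m => AddMonoidHom.mk' (fun x i => (φ i m).unop • x)
      fun x y => by ext; simp) fun m m' => by ext; simp [add_smul])
    fun b m x => by ext i; simp [mul_smul]

/-- The map `X^n → M ⊗_B X` given by elements of `M`. -/
def ofCoords {n : ℕ} (p : Fin n → M) (X : Type u) [AddCommGroup X] [Module B X] :
    (Fin n → X) →+ BalancedTensor k B M X :=
  ∑ i, (tmul k B (p i)).comp (Pi.evalAddMonoidHom (fun _ => X) i)

theorem ofCoords_apply {n : ℕ} (p : Fin n → M) (v : Fin n → X) :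
    ofCoords k M p X v = ∑ i, tmul k B (p i) (v i) := by
  simp [ofCoords]

theorem coords_map {n : ℕ} (φ : Fin n → M →ₗ[Bᵐᵒᵖ] Bᵐᵒᵖ) (f : X →ₗ[B] Y)
    (t : BalancedTensor k B M X) :
    coords k M φ Y (map k A M f t) = fun i => f (coords k M φ X t i) := by
  induction t using induction_on with
  | zero => ext; simp
  | tmul m x => ext i; simp [coords]
  | add s t hs ht => rw [_root_.map_add, _root_.map_add, hs, ht, _root_.map_add]; ext i; simp

theorem map_ofCoords {n : ℕ} (p : Fin n → M) (f : X →ₗ[B] Y) (v : Fin n → X) :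
    map k A M f (ofCoords k M p X v) = ofCoords k M p Y fun i => f (v i) := by
  simp [ofCoords_apply, _root_.map_sum]

/-- A dual basis of `M` over `Bᵐᵒᵖ` makes `M ⊗_B X` a retract of `Xⁿ`. By `coords_map` and
`map_ofCoords` the retraction is natural in `X`, which gives exactness of `M ⊗_B -` coordinatewise.
-/
theorem ofCoords_coords {n : ℕ} (φ : Fin n → M →ₗ[Bᵐᵒᵖ] Bᵐᵒᵖ) (p : Fin n → Bᵐᵒᵖ →ₗ[Bᵐᵒᵖ] M)
    (h : ∑ i, p i ∘ₗ φ i = LinearMap.id) (t : BalancedTensor k B M X) :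
    ofCoords k M (fun i => p i 1) X (coords k M φ X t) = t := by
  induction t using induction_on with
  | zero => simp
  | tmul m x =>
    have h' := LinearMap.congr_fun h m
    simp only [LinearMap.sum_apply, LinearMap.comp_apply, LinearMap.id_apply] at h'
    have hi : ∀ i, tmul k B (p i 1) ((φ i m).unop • x) = tmul k B (p i (φ i m)) x := fun i => by
      rw [← op_smul_tmul, MulOpposite.op_unop, ← map_smul, smul_eq_mul, mul_one]
    simp only [ofCoords_apply, coords, lift_tmul, AddMonoidHom.mk'_apply, hi]
    rw [← AddMonoidHom.finsetSum_apply, ← _root_.map_sum, h']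
  | add s t hs ht => rw [_root_.map_add, _root_.map_add, hs, ht]

/-! ### Exactness of `M ⊗_B -` for `M` finitely generated projective over `Bᵐᵒᵖ` -/

section Flat

variable [Module.Finite Bᵐᵒᵖ M] [Module.Projective Bᵐᵒᵖ M]

theorem map_injective {f : X →ₗ[B] Y} (hf : Function.Injective f) :
    Function.Injective (map k A M f) := by
  obtain ⟨n, p, φ, h⟩ := exists_sum_comp_eq_id (R := Bᵐᵒᵖ) M
  intro s t hst
  rw [← ofCoords_coords k M φ p h s, ← ofCoords_coords k M φ p h t]
  congr 1
  ext i
  have := congrArg (coords k M φ Y) hst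
  rw [coords_map, coords_map] at this
  exact hf (congrFun this i)

theorem map_surjective {f : X →ₗ[B] Y} (hf : Function.Surjective f) :
    Function.Surjective (map k A M f) := by
  obtain ⟨n, p, φ, h⟩ := exists_sum_comp_eq_id (R := Bᵐᵒᵖ) M
  intro t
  choose v hv using fun i => hf (coords k M φ Y t i)
  refine ⟨ofCoords k M (fun i => p i 1) X v, ?_⟩
  rw [map_ofCoords, funext hv, ofCoords_coords k M φ p h]

theorem map_exact {f : X →ₗ[B] Y} {g : Y →ₗ[B] W} (hfg : Function.Exact f g) :
    Function.Exact (map k A M f) (map k A M g) := by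
  obtain ⟨n, p, φ, h⟩ := exists_sum_comp_eq_id (R := Bᵐᵒᵖ) M
  intro t
  constructor
  · intro ht
    have hc : ∀ i, g (coords k M φ Y t i) = 0 := fun i => by
      have := congrArg (coords k M φ W) ht
      rw [coords_map, _root_.map_zero] at this
      exact congrFun this i
    -- The coordinates of a cycle are cycles in `Y`; they are lifted to `X` one by one and
    -- reassembled.
    choose v hv using fun i => (hfg _).1 (hc i)
    refine ⟨ofCoords k M (fun i => p i 1) X v, ?_⟩
    rw [map_ofCoords, funext hv, ofCoords_coords k M φ p h]
  · rintro ⟨t, rfl⟩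
    rw [← LinearMap.comp_apply, ← map_comp, hfg.linearMap_comp_eq_zero]
    induction t using induction_on with
    | zero => simp
    | tmul m x => simp
    | add s t hs ht => rw [_root_.map_add, hs, ht, add_zero]

end Flat

theorem finite [Module.Finite Bᵐᵒᵖ M] [Module.Projective Bᵐᵒᵖ M] [Module.Finite A M]
    [Module.Projective A M] (X : Type u) [AddCommGroup X] [Module B X] [Module.Finite B X] :
    Module.Finite A (BalancedTensor k B M X) := by
  obtain ⟨n, f, hf⟩ := Module.Finite.exists_fin' B X
  have := (finite_and_projective k A (B := B) M (Fin n → B)).1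
  exact Module.Finite.of_surjective _ (map_surjective k A M hf)

/-- Right projectivity of `M` keeps the sequences exact; left projectivity keeps their middle terms
projective. -/
theorem isSyzygy_map [Module.Finite Bᵐᵒᵖ M] [Module.Projective Bᵐᵒᵖ M] [Module.Finite A M]
    [Module.Projective A M] {n : ℕ} {X K : ModuleCat.{u} B} (h : IsSyzygy B n X K) :
    IsSyzygy A n (ModuleCat.of A (BalancedTensor k B M X))
      (ModuleCat.of A (BalancedTensor k B M K)) := by
  induction n generalizing K with
  | zero =>
    obtain ⟨e⟩ := h
    refine ⟨LinearEquiv.ofLinearMap (map k A M e.toLinearMap) (map k A M e.symm.toLinearMap) ?_ ?_⟩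
    · rw [← map_comp, LinearEquiv.comp_symm, map_id]
    · rw [← map_comp, LinearEquiv.symm_comp, map_id]
  | succ n ih =>
    obtain ⟨Y, P, f, g, hY, _, _, hf, hfg, hg⟩ := h
    obtain ⟨h₁, h₂⟩ := finite_and_projective k A (B := B) M P
    exact ⟨_, ModuleCat.of A (BalancedTensor k B M P), map k A M f, map k A M g, ih hY, h₁, h₂,
      map_injective k A M hf, map_exact k A M hfg, map_surjective k A M hg⟩

end Functor

/-! ### Functoriality of `M ⊗_B X` in the right module `M` -/

section MapLeft

variable {M'' : Type u} [AddCommGroup M''] [Module k M''] [Module Bᵐᵒᵖ M'']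
  [IsScalarTower k Bᵐᵒᵖ M'']

/-- The additive map `g ⊗_B X` for a map `g` of right `B`-modules. -/
def mapLeft (g : M →ₗ[Bᵐᵒᵖ] M') (X : Type u) [AddCommGroup X] [Module B X] :
    BalancedTensor k B M X →+ BalancedTensor k B M' X :=
  lift k ((tmul k B).comp g.toAddMonoidHom) fun b m x => by simp [op_smul_tmul]

@[simp]
theorem mapLeft_tmul (g : M →ₗ[Bᵐᵒᵖ] M') (m : M) (x : X) :
    mapLeft k g X (tmul k B m x) = tmul k B (g m) x :=
  rfl

theorem mapLeft_mapLeft (g' : M' →ₗ[Bᵐᵒᵖ] M'') (g : M →ₗ[Bᵐᵒᵖ] M')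
    (t : BalancedTensor k B M X) :
    mapLeft k g' X (mapLeft k g X t) = mapLeft k (g' ∘ₗ g) X t :=
  DFunLike.congr_fun (addHom_ext (f := (mapLeft k g' X).comp (mapLeft k g X))
    (g := mapLeft k (g' ∘ₗ g) X) fun _ _ => rfl) t

theorem mapLeft_id (t : BalancedTensor k B M X) : mapLeft k (LinearMap.id : M →ₗ[Bᵐᵒᵖ] M) X t = t :=
  DFunLike.congr_fun (addHom_ext (f := mapLeft k LinearMap.id X)
    (g := AddMonoidHom.id _) fun _ _ => rfl) t

theorem mapLeft_add (g g' : M →ₗ[Bᵐᵒᵖ] M') (t : BalancedTensor k B M X) :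
    mapLeft k (g + g') X t = mapLeft k g X t + mapLeft k g' X t :=
  DFunLike.congr_fun (addHom_ext (f := mapLeft k (g + g') X)
    (g := mapLeft k g X + mapLeft k g' X) fun m x => by simp) t

theorem mapLeft_zero (t : BalancedTensor k B M X) :
    mapLeft k (0 : M →ₗ[Bᵐᵒᵖ] M') X t = 0 :=
  DFunLike.congr_fun (addHom_ext (f := mapLeft k 0 X) (g := 0) fun m x => by simp) t

end MapLeft

end BalancedTensor

end BalancedTensor

/-! ### Bimodules and the functors `K ⊗_A Y` in the variable `K` -/

/-- A left `Aᵉ`-module `K`, viewed as an `A`-`A`-bimodule. -/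
def EnvBimodule (k : Type u) [Field k] (A : Type u) [Ring A] [Algebra k A] (K : Type u) : Type u :=
  K

namespace EnvBimodule

variable (k : Type u) [Field k] {A : Type u} [Ring A] [Algebra k A]
  {K L N : Type u} [AddCommGroup K] [Module (Env k A) K] [AddCommGroup L] [Module (Env k A) L]
  [AddCommGroup N] [Module (Env k A) N]

instance : AddCommGroup (EnvBimodule k A K) := ‹AddCommGroup K›

instance : Module k (EnvBimodule k A K) := Module.compHom K (algebraMap k (Env k A))

instance : Module A (EnvBimodule k A K) :=
  Module.compHom K
    (Algebra.TensorProduct.includeLeft : A →ₐ[k] Env k A).toRingHom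

instance : Module Aᵐᵒᵖ (EnvBimodule k A K) :=
  Module.compHom K (Algebra.TensorProduct.includeRight : Aᵐᵒᵖ →ₐ[k] Env k A).toRingHom

/-- The identity map from an `Aᵉ`-module to the corresponding bimodule. -/
def mk : K ≃+ EnvBimodule k A K := AddEquiv.refl K

theorem smul_mk (a : A) (x : K) :
    a • mk k (A := A) x = mk k ((a ⊗ₜ[k] (1 : Aᵐᵒᵖ) : Env k A) • x) :=
  rfl

theorem op_smul_mk (c : Aᵐᵒᵖ) (x : K) :
    c • mk k (A := A) x = mk k (((1 : A) ⊗ₜ[k] c : Env k A) • x) :=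
  rfl

instance : IsScalarTower k A (EnvBimodule k A K) :=
  IsScalarTower.of_algebraMap_smul fun _ _ => rfl

instance : IsScalarTower k Aᵐᵒᵖ (EnvBimodule k A K) :=
  IsScalarTower.of_algebraMap_smul fun c x =>
    congrArg (fun e : Env k A => mk k (A := A) (e • (mk k (A := A)).symm x))
      ((Algebra.TensorProduct.includeRight : Aᵐᵒᵖ →ₐ[k] Env k A).commutes c)

instance : SMulCommClass A Aᵐᵒᵖ (EnvBimodule k A K) where
  smul_comm a c x := by
    obtain ⟨x, rfl⟩ := (mk k (A := A)).surjective x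
    rw [op_smul_mk, smul_mk, smul_mk, op_smul_mk, smul_smul, smul_smul]
    simp

/-- An `Aᵉ`-linear map as a map of right `A`-modules. -/
def rightMap (f : K →ₗ[Env k A] L) : EnvBimodule k A K →ₗ[Aᵐᵒᵖ] EnvBimodule k A L where
  toFun x := mk k (f ((mk k (A := A)).symm x))
  map_add' x y := f.map_add x y
  map_smul' c x := f.map_smul ((1 : A) ⊗ₜ[k] c) x

theorem rightMap_id : rightMap k (LinearMap.id : K →ₗ[Env k A] K) = LinearMap.id :=
  rfl

theorem rightMap_comp (g : L →ₗ[Env k A] N) (f : K →ₗ[Env k A] L) :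
    rightMap k (g ∘ₗ f) = rightMap k g ∘ₗ rightMap k f :=
  rfl

theorem rightMap_sum {ι : Type*} (s : Finset ι) (f : ι → K →ₗ[Env k A] L) :
    rightMap k (∑ i ∈ s, f i) = ∑ i ∈ s, rightMap k (f i) := by
  ext x
  show (∑ i ∈ s, f i) ((mk k (A := A)).symm x) = _
  rw [LinearMap.sum_apply, LinearMap.sum_apply]
  rfl

variable (A) in
/-- The enveloping algebra is, as a right `A`-module, the free module `Aᵒᵖ ⊗ A`. -/
def envRightEquiv : (Aᵐᵒᵖ ⊗[k] A) ≃ₗ[Aᵐᵒᵖ] EnvBimodule k A (Env k A) where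
  __ := (TensorProduct.comm k Aᵐᵒᵖ A).toAddEquiv.trans (mk k)
  map_smul' c t := by
    show mk k (TensorProduct.comm k Aᵐᵒᵖ A (c • t)) = c • mk k (TensorProduct.comm k Aᵐᵒᵖ A t)
    induction t with
    | zero => simp
    | tmul a b => simp [op_smul_mk, TensorProduct.smul_tmul']
    | add s t hs ht => rw [smul_add, map_add, map_add, map_add, map_add, hs, ht, smul_add]

/-- Reduces to `P = Aᵉ`, which over `Aᵐᵒᵖ` is free on a `k`-basis of `A`. -/
theorem finite_and_projective_right [FiniteDimensional k A] (P : Type u) [AddCommGroup P]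
    [Module (Env k A) P] [Module.Finite (Env k A) P] [Module.Projective (Env k A) P] :
    Module.Finite Aᵐᵒᵖ (EnvBimodule k A P) ∧ Module.Projective Aᵐᵒᵖ (EnvBimodule k A P) := by
  have := Module.Finite.equiv (envRightEquiv k A)
  have := Module.Projective.of_equiv (envRightEquiv k A)
  apply FactorsThroughProjective.finite_and_projective
  obtain ⟨n, p, φ, h⟩ := exists_sum_comp_eq_id (R := Env k A) P
  rw [← rightMap_id, ← h, rightMap_sum]
  refine FactorsThroughProjective.sum _ fun i => ?_
  rw [rightMap_comp]
  exact FactorsThroughProjective.of_comp _ _ _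

/-- The `A`-linear map `f ⊗_A Y` for an `Aᵉ`-linear map `f`. -/
def tensorMap (f : K →ₗ[Env k A] L) (Y : Type u) [AddCommGroup Y] [Module A Y] :
    BalancedTensor k A (EnvBimodule k A K) Y →ₗ[A] BalancedTensor k A (EnvBimodule k A L) Y :=
  BalancedTensor.toLinear k (BalancedTensor.mapLeft k (rightMap k f) Y) fun a m y => by
    rw [BalancedTensor.mapLeft_tmul, BalancedTensor.mapLeft_tmul, BalancedTensor.smul_tmul]
    congr 1
    exact congrArg (fun z => BalancedTensor.tmul k A (mk k z))
      (f.map_smul (a ⊗ₜ[k] (1 : Aᵐᵒᵖ)) ((mk k (A := A)).symm m))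

section TensorMap

variable {Y : Type u} [AddCommGroup Y] [Module A Y]

@[simp]
theorem tensorMap_tmul (f : K →ₗ[Env k A] L) (m : EnvBimodule k A K) (y : Y) :
    tensorMap k f Y (BalancedTensor.tmul k A m y) =
      BalancedTensor.tmul k A (rightMap k f m) y :=
  rfl

theorem tensorMap_id : tensorMap k (LinearMap.id : K →ₗ[Env k A] K) Y = LinearMap.id :=
  BalancedTensor.linearMap_ext k A _ fun _ _ => rfl

theorem tensorMap_comp (g : L →ₗ[Env k A] N) (f : K →ₗ[Env k A] L) :
    tensorMap k (g ∘ₗ f) Y = tensorMap k g Y ∘ₗ tensorMap k f Y :=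
  BalancedTensor.linearMap_ext k A _ fun _ _ => rfl

theorem tensorMap_sub (f g : K →ₗ[Env k A] L) :
    tensorMap k (f - g) Y = tensorMap k f Y - tensorMap k g Y :=
  BalancedTensor.linearMap_ext k A _ fun m y => by
    have : rightMap k (f - g) m = rightMap k f m - rightMap k g m := rfl
    simp [this]

theorem tensorMap_sum {ι : Type*} (s : Finset ι) (f : ι → K →ₗ[Env k A] L) :
    tensorMap k (∑ i ∈ s, f i) Y = ∑ i ∈ s, tensorMap k (f i) Y :=
  BalancedTensor.linearMap_ext k A _ fun m y => by
    simp [rightMap_sum]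

end TensorMap

/-! ### Comparison of `Aᵉ ⊗_A Y` with `A ⊗_k Y` -/

section Free

variable (A) (Y : Type u) [AddCommGroup Y] [Module A Y]

/-- The biadditive map `(a, y) ↦ (a ⊗ 1) ⊗ y` to `Aᵉ ⊗_A Y`. -/
def freeTmul : A →+ Y →+ BalancedTensor k A (EnvBimodule k A (Env k A)) Y :=
  (BalancedTensor.tmul k A).comp ((mk k (A := A) (K := Env k A)).toAddMonoidHom.comp
    (Algebra.TensorProduct.includeLeft : A →ₐ[k] Env k A).toAddMonoidHom)

variable {Y} in
theorem freeTmul_apply (a : A) (y : Y) : freeTmul k A Y a y =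
    BalancedTensor.tmul k A (mk k (A := A) (a ⊗ₜ[k] (1 : Aᵐᵒᵖ) : Env k A)) y :=
  rfl

variable {Y} in
theorem tmul_tmul_eq_freeTmul (a : A) (c : Aᵐᵒᵖ) (y : Y) :
    BalancedTensor.tmul k A (mk k (A := A) (a ⊗ₜ[k] c : Env k A)) y =
      freeTmul k A Y a (c.unop • y) := by
  rw [freeTmul_apply, ← BalancedTensor.op_smul_tmul, op_smul_mk, MulOpposite.op_unop, smul_eq_mul,
    Algebra.TensorProduct.tmul_mul_tmul, one_mul, mul_one]

variable {Y} in
theorem smul_freeTmul (a b : A) (y : Y) : freeTmul k A Y (a • b) y = a • freeTmul k A Y b y := by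
  rw [freeTmul_apply, freeTmul_apply, BalancedTensor.smul_tmul, smul_mk, smul_eq_mul, smul_eq_mul,
    Algebra.TensorProduct.tmul_mul_tmul, one_mul]

variable [Module k Y] [IsScalarTower k A Y]

theorem freeTmul_smul (c : k) (a : A) (y : Y) :
    freeTmul k A Y (c • a) y = freeTmul k A Y a (c • y) := by
  rw [freeTmul_apply, TensorProduct.smul_tmul, tmul_tmul_eq_freeTmul, MulOpposite.unop_smul,
    MulOpposite.unop_one, smul_assoc, one_smul]

/-- The map `A ⊗_k Y → Aᵉ ⊗_A Y`, `a ⊗ y ↦ (a ⊗ 1) ⊗ y`. -/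
def ofFree : A ⊗[k] Y →ₗ[A] BalancedTensor k A (EnvBimodule k A (Env k A)) Y where
  __ := TensorProduct.liftAddHom (freeTmul k A Y) (freeTmul_smul k A Y)
  map_smul' a t := by
    show TensorProduct.liftAddHom _ (freeTmul_smul k A Y) (a • t) =
      a • TensorProduct.liftAddHom _ (freeTmul_smul k A Y) t
    induction t with
    | zero => simp only [smul_zero, map_zero]
    | tmul b y => exact smul_freeTmul k A a b y
    | add s t hs ht => rw [smul_add, map_add, map_add, hs, ht, smul_add]

variable {Y} in
theorem ofFree_tmul (a : A) (y : Y) : ofFree k A Y (a ⊗ₜ y) = freeTmul k A Y a y :=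
  rfl

/-- The map `Aᵉ ⊗ Y → A ⊗_k Y`, `(a ⊗ c, y) ↦ a ⊗ cy`. -/
def freeAction : Env k A →ₗ[k] Y →ₗ[k] A ⊗[k] Y :=
  TensorProduct.lift (LinearMap.mk₂ k
    (fun a c => TensorProduct.mk k A Y a ∘ₗ Algebra.lsmul k k Y (MulOpposite.unop c))
    (fun a a' c => by ext; simp)
    (fun r a c => by ext; simp [TensorProduct.smul_tmul'])
    (fun a c c' => by ext; simp [TensorProduct.tmul_add])
    (fun r a c => by ext; simp))

theorem freeAction_tmul (a : A) (c : Aᵐᵒᵖ) (y : Y) :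
    freeAction k A Y (a ⊗ₜ c) y = a ⊗ₜ (c.unop • y) :=
  rfl

/-- The map `Aᵉ ⊗_A Y → A ⊗_k Y`, `(a ⊗ c) ⊗ y ↦ a ⊗ cy`. -/
def toFree : BalancedTensor k A (EnvBimodule k A (Env k A)) Y →ₗ[A] A ⊗[k] Y :=
  BalancedTensor.toLinear k
    (BalancedTensor.lift k ((LinearMap.toAddMonoidHom'.comp
      (freeAction k A Y).toAddMonoidHom).comp (mk k).symm.toAddMonoidHom) fun b m y => by
        obtain ⟨e, rfl⟩ := (mk k).surjective m
        show freeAction k A Y (((1 : A) ⊗ₜ[k] MulOpposite.op b : Env k A) • e) y =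
          freeAction k A Y e (b • y)
        induction e using TensorProduct.induction_on with
        | zero => simp
        | tmul a c => simp [freeAction_tmul, mul_smul]
        | add s t hs ht => simp only [smul_add, map_add, LinearMap.add_apply, hs, ht])
    fun a m y => by
      obtain ⟨e, rfl⟩ := (mk k).surjective m
      show freeAction k A Y ((a ⊗ₜ[k] (1 : Aᵐᵒᵖ) : Env k A) • e) y =
        a • freeAction k A Y e y
      induction e using TensorProduct.induction_on with
      | zero => simp
      | tmul b c => simp [freeAction_tmul, TensorProduct.smul_tmul']
      | add s t hs ht => simp only [smul_add, map_add, LinearMap.add_apply, hs, ht]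

/-- Again a retraction is enough to pass projectivity from `A ⊗_k Y` to `Aᵉ ⊗_A Y`. -/
theorem ofFree_comp_toFree : ofFree k A Y ∘ₗ toFree k A Y = LinearMap.id :=
  BalancedTensor.linearMap_ext k A _ fun m y => by
    obtain ⟨e, rfl⟩ := (mk k).surjective m
    show ofFree k A Y (freeAction k A Y e y) = BalancedTensor.tmul k A (mk k e) y
    induction e using TensorProduct.induction_on with
    | zero => simp
    | tmul a c =>
      rw [freeAction_tmul, ofFree_tmul, tmul_tmul_eq_freeTmul]
    | add s t hs ht => simp only [map_add, LinearMap.add_apply, hs, ht, AddMonoidHom.add_apply]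

end Free

/-- The identity becomes a sum of maps through `A ⊗_k Y`, which is free over `A` since `k` is a
field, and finitely generated since `Y` is finite dimensional. -/
theorem finite_and_projective_tensor [FiniteDimensional k A] (P : Type u) [AddCommGroup P]
    [Module (Env k A) P] [Module.Finite (Env k A) P] [Module.Projective (Env k A) P]
    (Y : Type u) [AddCommGroup Y] [Module A Y] [Module.Finite A Y] :
    Module.Finite A (BalancedTensor k A (EnvBimodule k A P) Y) ∧
      Module.Projective A (BalancedTensor k A (EnvBimodule k A P) Y) := by
  let _ : Module k Y := Module.compHom Y (algebraMap k A)
  have : IsScalarTower k A Y := BalancedTensor.isScalarTower_compHom k Y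
  have : Module.Finite k Y := Module.Finite.trans A Y
  apply FactorsThroughProjective.finite_and_projective
  obtain ⟨n, p, φ, h⟩ := exists_sum_comp_eq_id (R := Env k A) P
  rw [← tensorMap_id, ← h, tensorMap_sum]
  refine FactorsThroughProjective.sum _ fun i => ?_
  rw [tensorMap_comp, ← LinearMap.id_comp (tensorMap k (φ i) Y), ← ofFree_comp_toFree,
    LinearMap.comp_assoc]
  exact (FactorsThroughProjective.of_comp (A ⊗[k] Y) _ _).comp_left _

/-- The functor `- ⊗_A Y` takes projective bimodules to projective modules, so it preserves the maps
that vanish stably. -/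
theorem stablyIsomorphic_tensor [FiniteDimensional k A] (h : StablyIsomorphic (Env k A) K L)
    (Y : Type u) [AddCommGroup Y] [Module A Y] [Module.Finite A Y] :
    StablyIsomorphic A (BalancedTensor k A (EnvBimodule k A K) Y)
      (BalancedTensor k A (EnvBimodule k A L) Y) := by
  have key : ∀ {K L : Type u} [AddCommGroup K] [Module (Env k A) K] [AddCommGroup L]
      [Module (Env k A) L] {f : K →ₗ[Env k A] L}, FactorsThroughProjective f →
      FactorsThroughProjective (tensorMap k f Y) := by
    rintro K L _ _ _ _ f ⟨P, g, h, _, _, rfl⟩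
    obtain ⟨_, _⟩ := finite_and_projective_tensor k (A := A) P Y
    rw [tensorMap_comp]
    exact FactorsThroughProjective.of_comp _ _ _
  obtain ⟨f, g, hgf, hfg⟩ := h
  refine ⟨tensorMap k f Y, tensorMap k g Y, ?_, ?_⟩
  · rw [← tensorMap_comp, ← tensorMap_id, ← tensorMap_sub]
    exact key hgf
  · rw [← tensorMap_comp, ← tensorMap_id, ← tensorMap_sub]
    exact key hfg

end EnvBimodule

namespace EnvBimodule

variable (k : Type u) [Field k] {A : Type u} [Ring A] [Algebra k A]
  {K : Type u} [AddCommGroup K] [Module (Env k A) K]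

/-! ### Syzygies of the regular bimodule -/

/-- An isomorphism of bimodules `K ≅ A` as an additive isomorphism. -/
def evalRegular (e : K ≃ₗ[Env k A] regularBimodule k A) : EnvBimodule k A K ≃+ A :=
  (mk k (A := A)).symm.trans e.toAddEquiv

theorem evalRegular_smul (e : K ≃ₗ[Env k A] regularBimodule k A) (a : A) (x : EnvBimodule k A K) :
    evalRegular k e (a • x) = a * evalRegular k e x := by
  let _ : Module (Env k A) A := TensorProduct.Algebra.module
  refine (e.map_smul (a ⊗ₜ[k] (1 : Aᵐᵒᵖ)) ((mk k (A := A)).symm x)).trans ?_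
  refine (TensorProduct.Algebra.smul_def (M := A) a (1 : Aᵐᵒᵖ) (evalRegular k e x)).trans ?_
  rw [one_smul, smul_eq_mul]

theorem evalRegular_op_smul (e : K ≃ₗ[Env k A] regularBimodule k A) (c : Aᵐᵒᵖ)
    (x : EnvBimodule k A K) : evalRegular k e (c • x) = evalRegular k e x * c.unop := by
  let _ : Module (Env k A) A := TensorProduct.Algebra.module
  refine (e.map_smul ((1 : A) ⊗ₜ[k] c) ((mk k (A := A)).symm x)).trans ?_
  refine (TensorProduct.Algebra.smul_def (M := A) (1 : A) c (evalRegular k e x)).trans ?_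
  rw [one_smul]
  rfl

/-- A bimodule isomorphic to `A` is free of rank one as a right module. -/
def rightEquivOfRegular (e : K ≃ₗ[Env k A] regularBimodule k A) :
    EnvBimodule k A K ≃ₗ[Aᵐᵒᵖ] Aᵐᵒᵖ where
  __ := (evalRegular k e).trans MulOpposite.opAddEquiv
  map_smul' c x := by
    show MulOpposite.op (evalRegular k e (c • x)) = c • MulOpposite.op (evalRegular k e x)
    rw [evalRegular_op_smul, MulOpposite.op_mul, MulOpposite.op_unop, smul_eq_mul]

/-- If `K ≅ A` as bimodules then `x ⊗ y ↦ xy` is a map `K ⊗_A Y → Y`. -/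
def tensorHomOfRegular (e : K ≃ₗ[Env k A] regularBimodule k A)
    (Y : Type u) [AddCommGroup Y] [Module A Y] :
    BalancedTensor k A (EnvBimodule k A K) Y →ₗ[A] Y :=
  BalancedTensor.toLinear k (BalancedTensor.lift k
    ((AddMonoidHom.smul : A →+ Y →+ Y).comp (evalRegular k e).toAddMonoidHom) fun b x y => by
      show evalRegular k e (MulOpposite.op b • x) • y = evalRegular k e x • b • y
      rw [evalRegular_op_smul, mul_smul, MulOpposite.unop_op]) fun a x y => by
      show evalRegular k e (a • x) • y = a • evalRegular k e x • y
      rw [evalRegular_smul, mul_smul]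

theorem tensorHomOfRegular_tmul (e : K ≃ₗ[Env k A] regularBimodule k A)
    {Y : Type u} [AddCommGroup Y] [Module A Y] (x : EnvBimodule k A K) (y : Y) :
    tensorHomOfRegular k e Y (BalancedTensor.tmul k A x y) = evalRegular k e x • y :=
  rfl

/-- If `K ≅ A` as bimodules then `K ⊗_A Y ≅ Y`. -/
def tensorEquivOfRegular (e : K ≃ₗ[Env k A] regularBimodule k A)
    (Y : Type u) [AddCommGroup Y] [Module A Y] :
    BalancedTensor k A (EnvBimodule k A K) Y ≃ₗ[A] Y :=
  { tensorHomOfRegular k e Y with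
    invFun := BalancedTensor.tmul k A ((evalRegular k e).symm 1)
    left_inv := fun t => by
      show BalancedTensor.tmul k A _ (tensorHomOfRegular k e Y t) = t
      induction t using BalancedTensor.induction_on with
      | zero => rw [map_zero, map_zero]
      | tmul x y =>
        rw [tensorHomOfRegular_tmul, ← BalancedTensor.op_smul_tmul]
        congr 2
        apply (evalRegular k e).injective
        rw [evalRegular_op_smul, AddEquiv.apply_symm_apply, one_mul, MulOpposite.unop_op]
      | add s t hs ht => rw [map_add, map_add, hs, ht]
    right_inv := fun y => by
      show evalRegular k e ((evalRegular k e).symm 1) • y = y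
      rw [AddEquiv.apply_symm_apply, one_smul] }

/-- Right projectivity of the bimodule syzygies is carried through the induction: it splits the next
sequence over `Aᵐᵒᵖ`, and split sequences stay exact under `- ⊗_A Y` for arbitrary `Y`. -/
theorem isSyzygy_tensor [FiniteDimensional k A] (Y : ModuleCat.{u} A) [Module.Finite A Y] {n : ℕ}
    {K : ModuleCat.{u} (Env k A)} (h : IsSyzygy (Env k A) n (regularBimodule k A) K) :
    Module.Projective Aᵐᵒᵖ (EnvBimodule k A K) ∧
      IsSyzygy A n Y (ModuleCat.of A (BalancedTensor k A (EnvBimodule k A K) Y)) := by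
  induction n generalizing K with
  | zero =>
    obtain ⟨e⟩ := h
    exact ⟨Module.Projective.of_equiv (rightEquivOfRegular k e).symm, ⟨tensorEquivOfRegular k e Y⟩⟩
  | succ n ih =>
    obtain ⟨Z, P, f, g, hZ, _, _, hf, hfg, hg⟩ := h
    obtain ⟨_, hZY⟩ := ih hZ
    obtain ⟨_, _⟩ := finite_and_projective_right k (A := A) P
    obtain ⟨h₁, h₂⟩ := finite_and_projective_tensor k (A := A) P Y
    have hf' : Function.Injective (rightMap k f) := hf
    have hfg' : Function.Exact (rightMap k f) (rightMap k g) := hfg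
    have hg' : Function.Surjective (rightMap k g) := hg
    -- `Z` is right projective by induction. The resulting `t` and `s'` are only right linear, so
    -- after tensoring they give additive maps, which is enough to check exactness.
    obtain ⟨s, hs⟩ := Module.projective_lifting_property (rightMap k g) LinearMap.id hg'
    obtain ⟨e, he₁, he₂⟩ := hfg'.splitSurjectiveEquiv hf' ⟨s, hs⟩
    let t : EnvBimodule k A P →ₗ[Aᵐᵒᵖ] EnvBimodule k A K := LinearMap.fst _ _ _ ∘ₗ e.toLinearMap
    let s' : EnvBimodule k A Z →ₗ[Aᵐᵒᵖ] EnvBimodule k A P := e.symm.toLinearMap ∘ₗ LinearMap.inr _ _ _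
    have htf : t ∘ₗ rightMap k f = LinearMap.id := by
      ext x; simp [t, he₁]
    have hgs : rightMap k g ∘ₗ s' = LinearMap.id := by
      ext x; simp [s', he₂]
    have hsum : rightMap k f ∘ₗ t + s' ∘ₗ rightMap k g = LinearMap.id := by
      ext x
      apply e.injective
      ext <;> simp [t, s', he₁, he₂]
    refine ⟨Module.Projective.of_split (rightMap k f) t htf, _,
      ModuleCat.of A (BalancedTensor k A (EnvBimodule k A P) Y), tensorMap k f Y, tensorMap k g Y,
      hZY, h₁, h₂, ?_, ?_, ?_⟩
    · refine Function.LeftInverse.injective (g := BalancedTensor.mapLeft k t Y) fun x => ?_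
      show BalancedTensor.mapLeft k t Y (BalancedTensor.mapLeft k (rightMap k f) Y x) = x
      rw [BalancedTensor.mapLeft_mapLeft, htf, BalancedTensor.mapLeft_id]
    · refine fun x => ⟨fun hx => ⟨BalancedTensor.mapLeft k t Y x, ?_⟩, ?_⟩
      · have hx' : BalancedTensor.mapLeft k (rightMap k g) Y x = 0 := hx
        show BalancedTensor.mapLeft k (rightMap k f) Y (BalancedTensor.mapLeft k t Y x) = x
        conv_rhs => rw [← BalancedTensor.mapLeft_id k x, ← hsum, BalancedTensor.mapLeft_add,
          ← BalancedTensor.mapLeft_mapLeft, ← BalancedTensor.mapLeft_mapLeft k s', hx', map_zero,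
          add_zero]
      · rintro ⟨x, rfl⟩
        show BalancedTensor.mapLeft k (rightMap k g) Y
          (BalancedTensor.mapLeft k (rightMap k f) Y x) = 0
        rw [BalancedTensor.mapLeft_mapLeft, hfg'.linearMap_comp_eq_zero,
          BalancedTensor.mapLeft_zero]
    · refine Function.RightInverse.surjective (g := BalancedTensor.mapLeft k s' Y) fun x => ?_
      show BalancedTensor.mapLeft k (rightMap k g) Y (BalancedTensor.mapLeft k s' Y x) = x
      rw [BalancedTensor.mapLeft_mapLeft, hgs, BalancedTensor.mapLeft_id]

end EnvBimodule

/-! ### Associativity -/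

section Assoc

variable (k : Type u) [Field k] (A B : Type u) [Ring A] [Algebra k A] [Ring B] [Algebra k B]
  (M N : Type u)
  [AddCommGroup M] [Module k M] [Module A M] [Module Bᵐᵒᵖ M]
  [IsScalarTower k A M] [IsScalarTower k Bᵐᵒᵖ M] [SMulCommClass A Bᵐᵒᵖ M]
  [AddCommGroup N] [Module k N] [Module B N] [Module Aᵐᵒᵖ N]
  [IsScalarTower k B N] [IsScalarTower k Aᵐᵒᵖ N] [SMulCommClass B Aᵐᵒᵖ N]

/-- The class of `n ⊗ m` in the bimodule `N ⊗_A M`. -/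
def tensorBimodule.tmul : N →+ M →+ EnvBimodule k B (tensorBimodule k B A N M) :=
  AddMonoidHom.mk' (fun n => AddMonoidHom.mk'
      (fun m => (Submodule.Quotient.mk (n ⊗ₜ[k] m) : TensorOver k A N M))
      fun x y => congrArg Submodule.Quotient.mk (TensorProduct.tmul_add n x y))
    fun n n' => AddMonoidHom.ext fun m =>
      congrArg Submodule.Quotient.mk (TensorProduct.add_tmul n n' m)

theorem tensorBimodule.op_smul_tmul (a : A) (n : N) (m : M) :
    tmul k A B M N (MulOpposite.op a • n) m = tmul k A B M N n (a • m) :=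
  (Submodule.Quotient.eq _).2 (Submodule.subset_span ⟨a, n, m, rfl⟩)

theorem tensorBimodule.smul_tmul (b : B) (n : N) (m : M) :
    b • tmul k A B M N n m = tmul k A B M N (b • n) m := by
  refine (tensorOverModule_smul k B A B N M b 1 n m).trans ?_
  rw [MulOpposite.op_one, one_smul]
  rfl

theorem tensorBimodule.smul_op_tmul (b : B) (n : N) (m : M) :
    MulOpposite.op b • tmul k A B M N n m = tmul k A B M N n (MulOpposite.op b • m) := by
  refine (tensorOverModule_smul k B A B N M 1 b n m).trans ?_
  rw [one_smul]
  rfl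

variable (Y : Type u) [AddCommGroup Y] [Module B Y]

/-- The map `N ⊗_A (M ⊗_B Y) → (N ⊗_A M) ⊗_B Y`. -/
def assocHom : BalancedTensor k A N (BalancedTensor k B M Y) →ₗ[B]
    BalancedTensor k B (EnvBimodule k B (tensorBimodule k B A N M)) Y := by
  -- The universal property is used twice: first over `B` for fixed `n`, then over `A` for `n`
  -- varying.
  let F : N → BalancedTensor k B M Y →+
      BalancedTensor k B (EnvBimodule k B (tensorBimodule k B A N M)) Y := fun n =>
    BalancedTensor.lift k ((BalancedTensor.tmul k B).comp (tensorBimodule.tmul k A B M N n))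
      fun b m y => by
        show BalancedTensor.tmul k B (tensorBimodule.tmul k A B M N n (MulOpposite.op b • m)) y = _
        rw [← tensorBimodule.smul_op_tmul, BalancedTensor.op_smul_tmul]
        rfl
  have hF : ∀ n m y, F n (BalancedTensor.tmul k B m y) =
    BalancedTensor.tmul k B (tensorBimodule.tmul k A B M N n m) y := fun n m y => rfl
  refine BalancedTensor.toLinear k (BalancedTensor.lift k (AddMonoidHom.mk' F fun n n' => ?_)
    fun a n t => ?_) fun b n t => ?_
  · refine BalancedTensor.addHom_ext fun m y => ?_
    simp [hF]
  · show F (MulOpposite.op a • n) t = F n (a • t)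
    induction t using BalancedTensor.induction_on with
    | zero => simp
    | tmul m y => rw [BalancedTensor.smul_tmul, hF, hF, tensorBimodule.op_smul_tmul]
    | add s t hs ht => rw [smul_add, map_add, map_add, hs, ht]
  · show F (b • n) t = b • F n t
    induction t using BalancedTensor.induction_on with
    | zero => simp
    | tmul m y => rw [hF, hF, BalancedTensor.smul_tmul, tensorBimodule.smul_tmul]
    | add s t hs ht => rw [map_add, map_add, hs, ht, smul_add]

/-- The additive map `N ⊗_A M → Hom(Y, N ⊗_A (M ⊗_B Y))`. -/
def tensorBimodule.action : EnvBimodule k B (tensorBimodule k B A N M) →+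
    Y →+ BalancedTensor k A N (BalancedTensor k B M Y) :=
  TensorOver.lift (k := k) (B := A) (M := N) (X := M)
    (AddMonoidHom.mk' (fun n => AddMonoidHom.mk'
        (fun m => (BalancedTensor.tmul k A n).comp (BalancedTensor.tmul k B m))
        fun m m' => by ext; simp)
      fun n n' => by ext; simp)
    fun a n m => by
      ext y
      exact BalancedTensor.op_smul_tmul k a n (BalancedTensor.tmul k B m y)

theorem tensorBimodule.action_tmul (n : N) (m : M) (y : Y) :
    action k A B M N Y (tmul k A B M N n m) y =
      BalancedTensor.tmul k A n (BalancedTensor.tmul k B m y) :=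
  rfl

@[elab_as_elim]
theorem tensorBimodule.induction_on {p : EnvBimodule k B (tensorBimodule k B A N M) → Prop}
    (t : EnvBimodule k B (tensorBimodule k B A N M))
    (zero : p 0) (tmul : ∀ n m, p (tmul k A B M N n m)) (add : ∀ s t, p s → p t → p (s + t)) :
    p t :=
  TensorOver.induction_on (k := k) (B := A) (M := N) (X := M) t zero tmul add

/-- The map `(N ⊗_A M) ⊗_B Y → N ⊗_A (M ⊗_B Y)`. -/
def assocInv : BalancedTensor k B (EnvBimodule k B (tensorBimodule k B A N M)) Y →+
    BalancedTensor k A N (BalancedTensor k B M Y) :=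
  BalancedTensor.lift k (tensorBimodule.action k A B M N Y) fun b t y => by
    induction t using tensorBimodule.induction_on with
    | zero => simp
    | tmul n m =>
      rw [tensorBimodule.smul_op_tmul, tensorBimodule.action_tmul, tensorBimodule.action_tmul,
        BalancedTensor.op_smul_tmul]
    | add s t hs ht =>
      rw [smul_add, map_add, map_add, AddMonoidHom.add_apply, AddMonoidHom.add_apply, hs, ht]

/-- `N ⊗_A (M ⊗_B Y) ≅ (N ⊗_A M) ⊗_B Y`. -/
def assocEquiv : BalancedTensor k A N (BalancedTensor k B M Y) ≃ₗ[B]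
    BalancedTensor k B (EnvBimodule k B (tensorBimodule k B A N M)) Y :=
  { assocHom k A B M N Y with
    invFun := assocInv k A B M N Y
    left_inv := fun t => by
      show assocInv k A B M N Y (assocHom k A B M N Y t) = t
      induction t using BalancedTensor.induction_on with
      | zero => simp
      | tmul n t =>
        induction t using BalancedTensor.induction_on with
        | zero => simp
        | tmul m y => rfl
        | add s t hs ht => rw [map_add, map_add, map_add, hs, ht]
      | add s t hs ht => rw [map_add, map_add, hs, ht]
    right_inv := fun t => by
      show assocHom k A B M N Y (assocInv k A B M N Y t) = t
      induction t using BalancedTensor.induction_on with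
      | zero => simp
      | tmul t y =>
        induction t using tensorBimodule.induction_on with
        | zero => simp
        | tmul n m => rfl
        | add s t hs ht =>
          rw [map_add, AddMonoidHom.add_apply, map_add, map_add, hs, ht]
      | add s t hs ht => rw [map_add, map_add, hs, ht] }

end Assoc

/-! ### Transfer along a singular equivalence -/

section Transfer

variable {k : Type u} [Field k] {A B : Type u} [Ring A] [Algebra k A]
  [Ring B] [Algebra k B] {M N : Type u}
  [AddCommGroup M] [Module k M] [Module A M] [Module Bᵐᵒᵖ M]
  [IsScalarTower k A M] [IsScalarTower k Bᵐᵒᵖ M] [SMulCommClass A Bᵐᵒᵖ M]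
  [AddCommGroup N] [Module k N] [Module B N] [Module Aᵐᵒᵖ N]
  [IsScalarTower k B N] [IsScalarTower k Aᵐᵒᵖ N] [SMulCommClass B Aᵐᵒᵖ N] {n : ℕ}

theorem IsSingularEquivalence.symm (h : IsSingularEquivalence k A B M N n) :
    IsSingularEquivalence k B A N M n where
  finite_left_M := h.finite_left_N
  projective_left_M := h.projective_left_N
  finite_right_M := h.finite_right_N
  projective_right_M := h.projective_right_N
  finite_left_N := h.finite_left_M
  projective_left_N := h.projective_left_M
  finite_right_N := h.finite_right_M
  projective_right_N := h.projective_right_M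
  tensor_MN := h.tensor_NM
  tensor_NM := h.tensor_MN

variable [FiniteDimensional k B]

/-- Both `K` and `Ωⁿ(B) ⊗_B Y` are `n`-th syzygies of `Y`, and the latter is stably `(N ⊗_A M) ⊗_B
Y`. -/
theorem IsSingularEquivalence.stableEq (h : IsSingularEquivalence k A B M N n)
    {Y K : ModuleCat.{u} B} (hY : Module.Finite B Y) (hK : IsSyzygy B n Y K) :
    StableEq B K (BalancedTensor k A N (BalancedTensor k B M Y)) := by
  obtain ⟨L, hL, hML⟩ := h.tensor_NM
  have h₁ := hK.stableEq (StableEq.of_equiv (LinearEquiv.refl B Y))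
    (EnvBimodule.isSyzygy_tensor k Y hL).2
  have h₂ := (EnvBimodule.stablyIsomorphic_tensor k hML Y).stableEq
  exact (h₁.trans h₂.symm).trans (StableEq.of_equiv (assocEquiv k A B M N Y).symm)

theorem IsSingularEquivalence.isSyzygyFinite [FiniteDimensional k A]
    (h : IsSingularEquivalence k A B M N n) (hA : IsSyzygyFinite A) : IsSyzygyFinite B := by
  have : IsArtinianRing A := IsArtinianRing.of_finite k A
  have : IsArtinianRing B := IsArtinianRing.of_finite k B
  have := h.finite_left_M
  have := h.projective_left_M
  have := h.finite_right_M
  have := h.projective_right_M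
  have := h.finite_left_N
  have := h.projective_left_N
  have := h.finite_right_N
  have := h.projective_right_N
  obtain ⟨s, r, L, hL⟩ := hA
  -- The list is not required to consist of finitely generated modules. Entries that are not can
  -- never be hit and are replaced by zero.
  have hex : ∀ i, ∃ E : ModuleCat.{u} A, Module.Finite A E ∧ (Module.Finite A (L i) → E = L i) :=
    fun i => by
      by_cases hi : Module.Finite A (L i)
      · exact ⟨L i, hi, fun _ => rfl⟩
      · exact ⟨ModuleCat.of A PUnit.{u + 1}, inferInstanceAs (Module.Finite A PUnit.{u + 1}),
          fun h => absurd h hi⟩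
  choose L' hL' hLL' using hex
  -- The factor `B` accounts for the summands of the projective correction term `Q`.
  let V := (∀ i, BalancedTensor k A N (L' i)) × B
  have hTL : ∀ i, Module.Finite B (BalancedTensor k A N (L' i)) := fun i =>
    BalancedTensor.finite k B N (L' i)
  obtain ⟨c, D, hD⟩ := exists_fin_indecomposable_summands (R := B) V
  -- The `n` last steps of the syzygy are used up by the equivalence; more than `s` remain for `A`.
  refine ⟨s + n, c, D, fun Z hZ hZi ⟨K, ⟨m, X, hm, hX, hK⟩, hZK⟩ => hD Z hZ hZi ?_⟩
  have := hZi.isLocalRing_end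
  obtain ⟨m, rfl⟩ : ∃ m', m = m' + n := ⟨m - n, by omega⟩
  obtain ⟨Y, hXY, hYK⟩ := hK.exists_of_add
  have hY := hXY.finite hX
  obtain ⟨P, Q, _, _, _, _, ⟨e⟩⟩ := h.stableEq hY hYK
  rcases isDirectSummand_or_of_prod ((hZK.trans .fst).trans (.of_equiv e)) with hZ' | hZ'
  · have := BalancedTensor.finite k A (B := B) M Y
    obtain ⟨ι, _, E, a, b, hE, hEs, hab⟩ :=
      exists_indecomposable_decomposition (R := A) (BalancedTensor k B M Y)
    -- Tensoring the decomposition of the identity of `M ⊗_B Y` with `N` places `Z` inside one `N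
    -- ⊗_A E i`, although `N ⊗_A E i` may decompose further.
    obtain ⟨i, -, hi⟩ := isDirectSummand_of_sum_eq_id hZ' Finset.univ
      (fun i => BalancedTensor k A N (E i))
      (fun i => BalancedTensor.map k B N (a i)) (fun i => BalancedTensor.map k B N (b i)) (by
        simp only [← BalancedTensor.map_comp]
        rw [← BalancedTensor.map_sum, hab, BalancedTensor.map_id])
    have hEf := (hEs i).finite
    obtain ⟨j, ⟨e'⟩⟩ := hL (E i) hEf (hE i)
      ⟨ModuleCat.of A (BalancedTensor k B M Y), ⟨m, _, by omega,
        BalancedTensor.finite k A M X, BalancedTensor.isSyzygy_map k A M hXY⟩, hEs i⟩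
    have hj : L' j = L j := hLL' j (Module.Finite.equiv e')
    have hEL : IsDirectSummand A (E i) (L' j) := hj ▸ .of_equiv e'
    refine (hi.trans (BalancedTensor.isDirectSummand_map k B N hEL)).trans
      (IsDirectSummand.trans (Y := ∀ i, BalancedTensor k A N (L' i)) ?_ .fst)
    exact ⟨LinearMap.single B (fun i => BalancedTensor k A N (L' i)) j, LinearMap.proj j, by ext; simp⟩
  · exact (isDirectSummand_ring_of_projective hZ').trans .snd

theorem IsSingularEquivalence.isIgusaTodorov [FiniteDimensional k A]
    (h : IsSingularEquivalence k A B M N n) (hA : IsIgusaTodorov A) : IsIgusaTodorov B := by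
  have : IsArtinianRing B := IsArtinianRing.of_finite k B
  have := h.finite_left_M
  have := h.projective_left_M
  have := h.finite_right_M
  have := h.projective_right_M
  have := h.finite_left_N
  have := h.projective_left_N
  have := h.finite_right_N
  have := h.projective_right_N
  obtain ⟨V, m, hV, hA⟩ := hA
  have hTV := BalancedTensor.finite k B (B := A) N V
  refine ⟨ModuleCat.of B (BalancedTensor k A N V × B), m + n,
    inferInstanceAs (Module.Finite B (BalancedTensor k A N V × B)), fun X K hX hK => ?_⟩
  obtain ⟨Y, hXY, hYK⟩ := hK.exists_of_add
  obtain ⟨P, Q, _, _, _, _, ⟨e⟩⟩ := h.stableEq (hXY.finite hX) hYK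
  obtain ⟨V₁, V₀, f, g, hV₁, hV₀, hf, hfg, hg⟩ := hA _ _ (BalancedTensor.finite k A (B := B) M X)
    (BalancedTensor.isSyzygy_map k A M hXY)
  have hf' := BalancedTensor.map_injective k B N hf
  have hfg' := BalancedTensor.map_exact k B N hfg
  have hg' := BalancedTensor.map_surjective k B N hg
  let W := BalancedTensor k A N V₀ × Q
  let π : W →ₗ[B] K × P :=
    e.symm.toLinearMap ∘ₗ (BalancedTensor.map k B N g).prodMap LinearMap.id
  have hπ : Function.Surjective π :=
    e.symm.surjective.comp (hg'.prodMap Function.surjective_id)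
  have hW : IsInAdd B W (BalancedTensor k A N V × B) :=
    ((BalancedTensor.isInAdd_map k B N hV₀).mono .fst).prod
      ((IsInAdd.of_projective (Q : Type u)).mono .snd)
  -- `E` is the preimage of `K` under `π`. It is a summand of `W` because `P` is projective, so it
  -- lies in the required `add`.
  let E := LinearMap.ker (LinearMap.snd B K P ∘ₗ π)
  obtain ⟨e'⟩ : Nonempty (W ≃ₗ[B] E × P) :=
    nonempty_equiv_prod_of_exact E.injective_subtype
      (LinearMap.exact_subtype_ker_map (LinearMap.snd B K P ∘ₗ π))
      ((LinearMap.snd_surjective (R := B) (M := K) (M₂ := P)).comp hπ)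
  have hE : ∀ x : E, (π x).2 = 0 := fun x => x.2
  have hπf : ∀ x, π (BalancedTensor.map k B N f x, 0) = 0 := fun x => by
    have h₁ : ((BalancedTensor.map k B N g) (BalancedTensor.map k B N f x), (0 : Q)) = 0 :=
      Prod.ext (hfg'.apply_apply_eq_zero x) rfl
    exact e.symm.map_eq_zero_iff.2 h₁
  -- The kernel of `π` is the image of `N ⊗_A V₁`. It lies in `E`, so it is also the kernel of `E →
  -- K`.
  let ι : BalancedTensor k A N V₁ →ₗ[B] E :=
    (LinearMap.inl B _ Q ∘ₗ BalancedTensor.map k B N f).codRestrict E fun x =>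
      congrArg Prod.snd (hπf x)
  refine ⟨ModuleCat.of B (BalancedTensor k A N V₁), ModuleCat.of B E, ι,
    LinearMap.fst B K P ∘ₗ π ∘ₗ E.subtype, (BalancedTensor.isInAdd_map k B N hV₁).mono .fst,
    hW.of_isDirectSummand (IsDirectSummand.fst.trans (.of_equiv e'.symm)), ?_, ?_, ?_⟩
  · intro x y hxy
    exact hf' (congrArg (fun z : E => z.1.1) hxy)
  · intro x
    constructor
    · intro hx
      have h₀ : π x.1 = 0 := Prod.ext hx (hE x)
      have h₁ : ((BalancedTensor.map k B N g) x.1.1, x.1.2) = 0 := e.symm.map_eq_zero_iff.1 h₀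
      obtain ⟨y, hy⟩ := (hfg' _).1 (congrArg Prod.fst h₁)
      exact ⟨y, Subtype.ext (Prod.ext hy (congrArg Prod.snd h₁).symm)⟩
    · rintro ⟨y, rfl⟩
      exact congrArg Prod.fst (hπf y)
  · intro z
    obtain ⟨w, hw⟩ := hπ (z, 0)
    exact ⟨⟨w, congrArg Prod.snd hw⟩, congrArg Prod.fst hw⟩

end Transfer

end SingularMorita

theorem proposition5p1 (k : Type u) [Field k] (A B : Type u)
    [Ring A] [Algebra k A] [FiniteDimensional k A]
    [Ring B] [Algebra k B] [FiniteDimensional k B]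
    (h : SingularMorita.SingularlyEquivalent k A B) :
    (SingularMorita.IsSyzygyFinite A ↔ SingularMorita.IsSyzygyFinite B) ∧
    (SingularMorita.IsIgusaTodorov A ↔ SingularMorita.IsIgusaTodorov B) := by
  obtain ⟨n, M, _, _, _, _, _, _, _, N, _, _, _, _, _, _, _, h⟩ := h
  exact ⟨⟨h.isSyzygyFinite, h.symm.isSyzygyFinite⟩, ⟨h.isIgusaTodorov, h.symm.isIgusaTodorov⟩⟩
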